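/- \textbf{Setting.} Let $\bar\Gamma=\bigcup_{j\in J}\bar e_j\subset\mathbb R^N$ be a finite topological network with finite vertex set $V=\{v_i\}_{i\in I}$ (pairwise different points): the edges are $\bar e_j=\pi_j([0,l_j])$, $e_j=\pi_j((0,l_j))$, $l_j>0$, with $\pi_j$ differentiable and injective on $[0,l_j]$, $\pi_j(0),\pi_j(l_j)\in V$, $\#(\bar e_j\cap V)=2$; for $j\ne k$, $\bar e_j\cap\bar e_k\subset V$ has at most one point; and any two vertices are joined by a chain of edges (a nonempty finite sequence in which consecutive closed edges share exactly one point). Edge $j$ is incident to $v_i$, $j\in Inc_i$, if $v_i\in\bar e_j$; put $a_{ij}=1$ if $\pi_j(0)=v_i$, $a_{ij}=-1$ if $\pi_j(l_j)=v_i$, and $0$ otherwise. A nonempty set of vertices, containing every vertex with exactly one incident edge, is chosen as boundary $\partial\Gamma$; the other vertices are transition vertices, and $\Gamma=\bar\Gamma\setminus\partial\Gamma$. For $x\in\bar e_j$, $\partial_j\phi(x)$ is the derivative of $\phi\circ\pi_j$ on $[0,l_j]$ at $\pi_j^{-1}(x)$ (one-sided at a vertex), and $\phi$ is differentiable along $e_j$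 at $x$ if this derivative exists. At a transition vertex $v_i$, $\phi$ is $(j,k)$-differentiable ($j\neq k$ in $Inc_i$) if it is differentiable along $e_j$ and along $e_k$ at $v_i$ and $a_{ij}\partial_j\phi(v_i)+a_{ik}\partial_k\phi(v_i)=0$. A function in $C(\Gamma)$ is differentiable in $\Gamma$ if it is differentiable along $e_j$ at all points of each $e_j$ and $(j,k)$-differentiable at each transition vertex for all pairs $j\ne k$ of incident edges. The Hamiltonian is a family $H^j:[0,l_j]\times\mathbb R\to\mathbb R$, $j\in J$, of continuous functions, convex in $p$, with $H^j(s,p)\to+\infty$ as $|p|\to\infty$ for each $s$, such that at each vertex $v_i$ the function $H^j(\pi_j^{-1}(v_i),p)$ is the same for all $j\in Inc_i$ and is even in $p$. Write $H^j(x,p)=H^j(\pi_j^{-1}(x),p)$. Let $\Omega\subseteq\Gamma$. A function $u\in \mathrm{USC}(\bar\Gamma)$ is a subsolution of $H(x,Du)=0$ in $\Omega$ if $H^j(x,\partial_j\phi(x))\le 0$ whenever $\phi\in C(\Gamma)$, $u-\phi$ has a local maximum relative to $\Gamma$ at $x\in\Omega$, and either $x\in e_j$ and $\phi$ is differentiable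 along $e_j$ at $x$, or $x=v_i$ is a transition vertex and $\phi$ is $(j,k)$-differentiable at $x$ for some $j,k\in Inc_i$, $j\ne k$. A function $u\in \mathrm{LSC}(\bar\Gamma)$ is a supersolution in $\Omega$ if (i) $H^j(x,\partial_j\phi(x))\ge0$ whenever $x\in e_j\cap\Omega$, $\phi\in C(\Gamma)$ is differentiable along $e_j$ at $x$ and $u-\phi$ has a local minimum relative to $\Gamma$ at $x$; and (ii) for each transition vertex $x=v_i\in\Omega$ and each $j\in Inc_i$ there is $k\in Inc_i$, $k\ne j$, such that $H^j(x,\partial_j\phi(x))\ge0$ for every $\phi\in C(\Gamma)$ that is $(j,k)$-differentiable at $x$ and for which $u-\phi$ has a local minimum relative to $\Gamma$ at $x$. A solution in $\Omega$ is a function in $C(\bar\Gamma)$ that is both. For a constant $c$, sub- and supersolutions of $H(x,Du)=c$ are those for the Hamiltonian $H-c$. For $x,y\in\bar\Gamma$ let \[S(y,x)=\inf_\gamma\int_0^t L(\gamma(s),\dot\gamma(s))\,ds,\qquad L^j(x,q)=\sup_{p\in\mathbb R}\{pq-H^j(x,p)\},\] the infimum being over all $t>0$ and all continuous $\gamma:[0,t]\to\bar\Gamma$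 with $\gamma(0)=y$, $\gamma(t)=x$ for which there is a partition $0=t_0<\dots<t_{n+1}=t$ such that on each $[t_m,t_{m+1}]$ the path $\gamma$ stays in one closed edge $\bar e_{j_m}$ and $\pi_{j_m}^{-1}\circ\gamma$ is $C^1$ on $(t_m,t_{m+1})$; there $L=L^{j_m}$ and $\dot\gamma=\frac{d}{ds}(\pi_{j_m}^{-1}\circ\gamma)$. \textbf{Assumptions.} There is a subsolution $w\in C(\bar\Gamma)$ of $H(x,Du)=0$ in $\Gamma$. Moreover $K\subseteq\Gamma$ is relatively closed in $\Gamma$ (possibly empty) and there are a function $\psi\in C(\Gamma)$ differentiable in $\Gamma$ and $h\in C(\Gamma)$ with $h<0$ in $\Gamma\setminus K$ such that $H^j(x,\partial_j\psi(x))\le h(x)$ for all $x\in\Gamma\setminus K$ and all $j$ with $x\in\bar e_j$. \textbf{Proposition.} Let $g:\bar\Gamma\to\mathbb R$ be continuous (no compatibility condition is imposed). Then for every $x\in\bar\Gamma$ the minimum \[u(x)=\min\{g(y)+S(y,x):\ y\in K\cup\partial\Gamma\}\] is attained and is a real number, and: \begin{enumerate} \item $u\in C(\bar\Gamma)$, $u\le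 g$ on $K\cup\partial\Gamma$, and $u$ is a subsolution of $H(x,Du)=0$ in $\Gamma$ and a supersolution in $\Gamma\setminus K$; in particular $u$ is a solution in $\Gamma\setminus K$. \item If $K$ consists of degenerate points, then $u$ is a solution of $H(x,Du)=0$ in all of $\Gamma$. Here $y\in\Gamma$ is called degenerate if there are no $w\in C(\bar\Gamma)$, $\delta>0$ and open $U\ni y$ such that $w$ is a subsolution of $H(x,Dw)=0$ in $\Gamma$ and of $H(x,Dw)=-\delta$ in $\Gamma\cap U$. \item $u$ is maximal: if $v\in C(\bar\Gamma)$ is a subsolution in $\Gamma$ and a supersolution in $\Gamma\setminus K$ (for instance a solution in $\Gamma$) and $v\le g$ on $K\cup\partial\Gamma$, then $v\le u$ on $\bar\Gamma$. \end{enumerate} -/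

import Mathlib

open Set Filter Topology MeasureTheory

/-- A finite topological network in `ℝ^N` with vertices indexed by `I`, edges indexed by `J`,
together with a choice of boundary vertices `bdryIdx`. The arc of the edge `j` is the restriction
of `arc j` to `[0, len j]`. -/
structure TopNetwork (N : ℕ) (I J : Type*) where
  vert : I → EuclideanSpace ℝ (Fin N)
  len : J → ℝ
  arc : J → ℝ → EuclideanSpace ℝ (Fin N)
  bdryIdx : Set I
  vert_injective : Function.Injective vert
  len_pos : ∀ j, 0 < len j
  arc_differentiable : ∀ j, DifferentiableOn ℝ (arc j) (Icc 0 (len j))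
  arc_injective : ∀ j, InjOn (arc j) (Icc 0 (len j))
  arc_start : ∀ j, arc j 0 ∈ range vert
  arc_end : ∀ j, arc j (len j) ∈ range vert
  two_vertices : ∀ j, (arc j '' Icc 0 (len j) ∩ range vert).ncard = 2
  inter_subset : ∀ j k, j ≠ k →
    arc j '' Icc 0 (len j) ∩ arc k '' Icc 0 (len k) ⊆ range vert
  inter_subsingleton : ∀ j k, j ≠ k →
    (arc j '' Icc 0 (len j) ∩ arc k '' Icc 0 (len k)).Subsingleton
  connected : ∀ a b : I, ∃ (n : ℕ) (e : Fin (n + 1) → J),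
    vert a ∈ arc (e 0) '' Icc 0 (len (e 0)) ∧
    vert b ∈ arc (e (Fin.last n)) '' Icc 0 (len (e (Fin.last n))) ∧
    ∀ m : Fin n, (arc (e m.castSucc) '' Icc 0 (len (e m.castSucc)) ∩
      arc (e m.succ) '' Icc 0 (len (e m.succ))).ncard = 1
  bdryIdx_nonempty : bdryIdx.Nonempty
  bdryIdx_of_leaf : ∀ i, {j | vert i ∈ arc j '' Icc 0 (len j)}.ncard = 1 → i ∈ bdryIdx

namespace TopNetwork

variable {N : ℕ} {I J : Type*} (G : TopNetwork N I J)

/-- The closed edge `ē_j`. -/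
def closedEdge (j : J) : Set (EuclideanSpace ℝ (Fin N)) := G.arc j '' Icc 0 (G.len j)

/-- The open edge `e_j`. -/
def openEdge (j : J) : Set (EuclideanSpace ℝ (Fin N)) := G.arc j '' Ioo 0 (G.len j)

/-- The whole network `Γ̄`, the union of the closed edges. -/
def total : Set (EuclideanSpace ℝ (Fin N)) := ⋃ j, G.closedEdge j

/-- The set `∂Γ` of boundary vertices. -/
def bdry : Set (EuclideanSpace ℝ (Fin N)) := G.vert '' G.bdryIdx

/-- `Γ = Γ̄ ∖ ∂Γ`. -/
def inner : Set (EuclideanSpace ℝ (Fin N)) := G.total \ G.bdry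

/-- The edge `j` is incident to the vertex `i`. -/
def Inc (i : I) (j : J) : Prop := G.vert i ∈ G.closedEdge j

open Classical in
/-- The signed incidence matrix. -/
noncomputable def sgn (i : I) (j : J) : ℝ :=
  if G.arc j 0 = G.vert i then 1 else if G.arc j (G.len j) = G.vert i then -1 else 0

/-- The coordinate `π_j⁻¹(x) ∈ [0, len j]` of a point `x` of the closed edge `j`. -/
noncomputable def coord (j : J) (x : EuclideanSpace ℝ (Fin N)) : ℝ :=
  Function.invFunOn (G.arc j) (Icc 0 (G.len j)) x

/-- `φ` is differentiable along the edge `j` at the point `x ∈ ē_j` (one-sidedly at a vertex). -/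
def EdgeDiffAt (j : J) (φ : EuclideanSpace ℝ (Fin N) → ℝ) (x : EuclideanSpace ℝ (Fin N)) : Prop :=
  DifferentiableWithinAt ℝ (fun s => φ (G.arc j s)) (Icc 0 (G.len j)) (G.coord j x)

/-- The derivative `∂_j φ(x)` along the edge `j` at `x ∈ ē_j` (one-sided at a vertex). -/
noncomputable def edgeDeriv (j : J) (φ : EuclideanSpace ℝ (Fin N) → ℝ)
    (x : EuclideanSpace ℝ (Fin N)) : ℝ :=
  derivWithin (fun s => φ (G.arc j s)) (Icc 0 (G.len j)) (G.coord j x)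

/-- `φ` is `(j,k)`-differentiable at the vertex `i`. -/
def JKDiffAt (i : I) (j k : J) (φ : EuclideanSpace ℝ (Fin N) → ℝ) : Prop :=
  G.EdgeDiffAt j φ (G.vert i) ∧ G.EdgeDiffAt k φ (G.vert i) ∧
    G.sgn i j * G.edgeDeriv j φ (G.vert i) + G.sgn i k * G.edgeDeriv k φ (G.vert i) = 0

/-- `φ ∈ C(Γ)` is differentiable at all points of `Γ`: along every open edge, and
`(j,k)`-differentiable for all pairs of incident edges at every transition vertex. -/
def DiffOnInner (φ : EuclideanSpace ℝ (Fin N) → ℝ) : Prop :=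
  ContinuousOn φ G.inner ∧
  (∀ j, ∀ x ∈ G.openEdge j, G.EdgeDiffAt j φ x) ∧
  (∀ i, i ∉ G.bdryIdx → ∀ j k, G.Inc i j → G.Inc i k → j ≠ k → G.JKDiffAt i j k φ)

/-- Hamiltonians of eikonal type on the network; `H j s p` is `H^j(s,p)` for `s ∈ [0, len j]`. -/
structure IsEikonal (H : J → ℝ → ℝ → ℝ) : Prop where
  continuous : ∀ j, ContinuousOn (fun z : ℝ × ℝ => H j z.1 z.2) (Icc 0 (G.len j) ×ˢ univ)
  convex : ∀ j, ∀ s ∈ Icc 0 (G.len j), ConvexOn ℝ univ (H j s)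
  coercive : ∀ j, ∀ s ∈ Icc 0 (G.len j), Tendsto (H j s) (cocompact ℝ) atTop
  compat : ∀ i j k, G.Inc i j → G.Inc i k → ∀ p,
    H j (G.coord j (G.vert i)) p = H k (G.coord k (G.vert i)) p
  even : ∀ i j, G.Inc i j → ∀ p,
    H j (G.coord j (G.vert i)) p = H j (G.coord j (G.vert i)) (-p)

/-- `u ∈ USC(Γ̄)` is a viscosity subsolution of `H(x,Du) = 0` at the points of `Ω ⊆ Γ`. -/
def IsSubsolution (H : J → ℝ → ℝ → ℝ) (Ω : Set (EuclideanSpace ℝ (Fin N)))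
    (u : EuclideanSpace ℝ (Fin N) → ℝ) : Prop :=
  UpperSemicontinuousOn u G.total ∧
  (∀ j, ∀ x ∈ G.openEdge j, x ∈ Ω → ∀ φ : EuclideanSpace ℝ (Fin N) → ℝ,
    ContinuousOn φ G.inner → G.EdgeDiffAt j φ x →
    IsLocalMaxOn (fun z => u z - φ z) G.inner x →
    H j (G.coord j x) (G.edgeDeriv j φ x) ≤ 0) ∧
  (∀ i, i ∉ G.bdryIdx → G.vert i ∈ Ω → ∀ j k, G.Inc i j → G.Inc i k → j ≠ k →
    ∀ φ : EuclideanSpace ℝ (Fin N) → ℝ,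
    ContinuousOn φ G.inner → G.JKDiffAt i j k φ →
    IsLocalMaxOn (fun z => u z - φ z) G.inner (G.vert i) →
    H j (G.coord j (G.vert i)) (G.edgeDeriv j φ (G.vert i)) ≤ 0)

/-- `u ∈ LSC(Γ̄)` is a viscosity supersolution of `H(x,Du) = 0` at the points of `Ω ⊆ Γ`. At a
transition vertex every incident edge `j` must have a feasible partner `k`. -/
def IsSupersolution (H : J → ℝ → ℝ → ℝ) (Ω : Set (EuclideanSpace ℝ (Fin N)))
    (u : EuclideanSpace ℝ (Fin N) → ℝ) : Prop :=
  LowerSemicontinuousOn u G.total ∧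
  (∀ j, ∀ x ∈ G.openEdge j, x ∈ Ω → ∀ φ : EuclideanSpace ℝ (Fin N) → ℝ,
    ContinuousOn φ G.inner → G.EdgeDiffAt j φ x →
    IsLocalMinOn (fun z => u z - φ z) G.inner x →
    0 ≤ H j (G.coord j x) (G.edgeDeriv j φ x)) ∧
  (∀ i, i ∉ G.bdryIdx → G.vert i ∈ Ω → ∀ j, G.Inc i j →
    ∃ k, G.Inc i k ∧ k ≠ j ∧ ∀ φ : EuclideanSpace ℝ (Fin N) → ℝ,
      ContinuousOn φ G.inner → G.JKDiffAt i j k φ →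
      IsLocalMinOn (fun z => u z - φ z) G.inner (G.vert i) →
      0 ≤ H j (G.coord j (G.vert i)) (G.edgeDeriv j φ (G.vert i)))

/-- Viscosity solutions at the points of `Ω ⊆ Γ`. -/
def IsSolution (H : J → ℝ → ℝ → ℝ) (Ω : Set (EuclideanSpace ℝ (Fin N)))
    (u : EuclideanSpace ℝ (Fin N) → ℝ) : Prop :=
  ContinuousOn u G.total ∧ G.IsSubsolution H Ω u ∧ G.IsSupersolution H Ω u

/-- A continuous, piecewise continuously differentiable path in `Γ̄` from `y` to `x`, defined on
`[0, t]` with `t = τ (Fin.last _) > 0`; on `[τ_m, τ_{m+1}]` it stays in one closed edge. -/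
structure NetPath (y x : EuclideanSpace ℝ (Fin N)) where
  n : ℕ
  τ : Fin (n + 2) → ℝ
  edge : Fin (n + 1) → J
  γ : ℝ → EuclideanSpace ℝ (Fin N)
  τ_zero : τ 0 = 0
  τ_strictMono : StrictMono τ
  continuousOn : ContinuousOn γ (Icc 0 (τ (Fin.last (n + 1))))
  mem_edge : ∀ m : Fin (n + 1), ∀ s ∈ Icc (τ m.castSucc) (τ m.succ), γ s ∈ G.closedEdge (edge m)
  contDiffOn : ∀ m : Fin (n + 1),
    ContDiffOn ℝ 1 (fun s => G.coord (edge m) (γ s)) (Ioo (τ m.castSucc) (τ m.succ))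
  start_eq : γ 0 = y
  end_eq : γ (τ (Fin.last (n + 1))) = x

end TopNetwork

/-- `L(q) = sup_p (p q - h(p))`, with values in `(-∞, ∞]`. -/
noncomputable def lagrangian (h : ℝ → ℝ) (q : ℝ) : EReal := ⨆ p : ℝ, ((p * q - h p : ℝ) : EReal)

/-- The integral over `s` of an extended-real function whose negative part has finite integral. -/
noncomputable def erealIntegral (s : Set ℝ) (f : ℝ → EReal) : EReal :=
  ((∫⁻ r in s, (f r).toENNReal : ENNReal) : EReal) -
    ((∫⁻ r in s, (-f r).toENNReal : ENNReal) : EReal)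

namespace TopNetwork

variable {N : ℕ} {I J : Type*} (G : TopNetwork N I J)

/-- The action `∫ L(γ, γ̇) ds` of a path. -/
noncomputable def NetPath.action {G : TopNetwork N I J} {y x : EuclideanSpace ℝ (Fin N)}
    (H : J → ℝ → ℝ → ℝ) (c : G.NetPath y x) : EReal :=
  ∑ m : Fin (c.n + 1), erealIntegral (Ioo (c.τ m.castSucc) (c.τ m.succ)) fun s =>
    lagrangian (H (c.edge m) (G.coord (c.edge m) (c.γ s)))
      (deriv (fun r => G.coord (c.edge m) (c.γ r)) s)

/-- `S(y,x)`: the infimum of the action over all paths from `y` to `x`. -/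
noncomputable def dist (H : J → ℝ → ℝ → ℝ) (y x : EuclideanSpace ℝ (Fin N)) : EReal :=
  ⨅ c : G.NetPath y x, c.action H

/-- The points of `Γ` near which no continuous subsolution of `H(x,Du) = 0` in `Γ` is strict. -/
def degenerateSet (H : J → ℝ → ℝ → ℝ) : Set (EuclideanSpace ℝ (Fin N)) :=
  {y | y ∈ G.inner ∧ ¬ ∃ w : EuclideanSpace ℝ (Fin N) → ℝ,
    ContinuousOn w G.total ∧ G.IsSubsolution H G.inner w ∧
    ∃ δ > 0, ∃ U, IsOpen U ∧ y ∈ U ∧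
      G.IsSubsolution (fun j s p => H j s p + δ) (G.inner ∩ U) w}

/-- There are a differentiable `ψ` and `h ∈ C(Γ)`, `h < 0` on `Γ ∖ K`, with `H(x,Dψ) ≤ h(x)` on
`Γ ∖ K`. -/
def HasStrictSubsolutionOff (H : J → ℝ → ℝ → ℝ) (K : Set (EuclideanSpace ℝ (Fin N))) : Prop :=
  ∃ ψ h : EuclideanSpace ℝ (Fin N) → ℝ, G.DiffOnInner ψ ∧ ContinuousOn h G.inner ∧
    (∀ x ∈ G.inner \ K, h x < 0) ∧
    ∀ x ∈ G.inner \ K, ∀ j, x ∈ G.closedEdge j → H j (G.coord j x) (G.edgeDeriv j ψ x) ≤ h x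

end TopNetwork

/-!
The proof characterises continuous subsolutions by the intrinsic distance `S`: a function `u` is a
continuous subsolution of `H(x, Du) = 0` in `Γ` exactly when `u x - u y ≤ S(y, x)` for all `x, y`.

If `v` is a continuous subsolution, then coercivity makes it Lipschitz along every edge. Along a
`C¹` piece `σ` of a path, at almost every time, either `σ' = 0` and `v ∘ σ` is stationary, or `v` is
differentiable at the point reached, where its slope `p` satisfies `H ≤ 0`; in both cases
`(v ∘ σ)' ≤ L(σ, σ')`. Integration gives `v x - v y ≤ S(y, x)`
(`TopNetwork.IsSubsolution.sub_le_dist`).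

Conversely, let `u` be dominated by `S` and let a test function with slope `p` touch it from above.
If `p` were outside the sublevel set `Z = {H ≤ 0}`, an interval, then a convexity argument provides
a constant speed `q` whose Lagrangian is at most `p₁ q` at all nearby points, for some `p₁` between
`Z` and `p` (`eventually_lagrangian_le_of_gt`). Moving towards the touching point with this speed is
cheaper than `u` allows. At a transition vertex the two outgoing slopes of a `(j,k)`-differentiable
function are opposite, so along one of the two edges the path arrives on the required side
(`TopNetwork.isSubsolution_of_sub_le_dist`).

The minimum `u` of `g(y) + S(y, ·)` over the compact set `K ∪ ∂Γ` is dominated by `S`, hence a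
continuous subsolution, and by the first half it is the largest one below `g` on `K ∪ ∂Γ`. The
supersolution property follows by Perron's method. If it fails at `x`, then along all edges near
`x` the function `u` lies above a cone with vertex over `x` all of whose slopes are strictly
admissible. Lifting the cone and taking the maximum with `u` yields a subsolution `w` that equals
`u` away from `x`, exceeds it at `x`, and is strict near `x` (`TopNetwork.IsSubsolution.exists_bump`).
For `x ∉ K` this contradicts maximality; for a degenerate `x` it contradicts degeneracy.
-/

/-! ### Convex coercive functions depending continuously on a parameter -/

theorem ConvexOn.comp_neg_univ {f : ℝ → ℝ} (hf : ConvexOn ℝ univ f) :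
    ConvexOn ℝ univ (fun p => f (-p)) := by
  refine ⟨convex_univ, fun x _ y _ a b ha hb hab => ?_⟩
  have := hf.2 (mem_univ (-x)) (mem_univ (-y)) ha hb hab
  simpa [neg_add, add_comm, smul_eq_mul, mul_neg] using this

theorem ConvexOn.add_mul_div_le {f : ℝ → ℝ} (hf : ConvexOn ℝ univ f) {R p c : ℝ} (hR : 0 < R)
    (hRp : R ≤ p) (h : f 0 + c ≤ f R) : f 0 + c * (p / R) ≤ f p := by
  have hp : 0 < p := hR.trans_le hRp
  have hRp' : R / p ≤ 1 := (div_le_one hp).2 hRp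
  have := hf.2 (mem_univ (0 : ℝ)) (mem_univ p) (by linarith : 0 ≤ 1 - R / p)
    (by positivity : 0 ≤ R / p) (by ring)
  simp only [smul_eq_mul, mul_zero, zero_add, div_mul_cancel₀ _ hp.ne'] at this
  have h2 : c ≤ R / p * (f p - f 0) := by linarith
  have h3 : c * (p / R) ≤ R / p * (f p - f 0) * (p / R) :=
    mul_le_mul_of_nonneg_right h2 (by positivity)
  have h4 : R / p * (f p - f 0) * (p / R) = f p - f 0 := by field_simp
  linarith

theorem exists_add_one_lt {f : ℝ → ℝ} (hf : Tendsto f (cocompact ℝ) atTop) :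
    ∃ R > 0, f 0 + 1 < f R ∧ f 0 + 1 < f (-R) := by
  rw [cocompact_eq_atBot_atTop, tendsto_sup] at hf
  have h1 := hf.2.eventually_gt_atTop (f 0 + 1)
  have h2 := (hf.1.comp tendsto_neg_atTop_atBot).eventually_gt_atTop (f 0 + 1)
  obtain ⟨R, ⟨h1, h2⟩, h3⟩ := ((h1.and h2).and (eventually_gt_atTop 0)).exists
  exact ⟨R, h3, h1, h2⟩

section Family

variable {S : Set ℝ} {F : ℝ → ℝ → ℝ}

theorem eventually_lt_of_continuousOn (hF : ContinuousOn (fun z : ℝ × ℝ => F z.1 z.2) (S ×ˢ univ))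
    {s₀ p₀ c : ℝ} (hs₀ : s₀ ∈ S) (h : c < F s₀ p₀) :
    ∀ᶠ z : ℝ × ℝ in 𝓝 (s₀, p₀), z.1 ∈ S → c < F z.1 z.2 := by
  have h1 : ContinuousWithinAt (fun z : ℝ × ℝ => F z.1 z.2) (S ×ˢ univ) (s₀, p₀) :=
    hF _ ⟨hs₀, mem_univ _⟩
  have h2 := h1.eventually (lt_mem_nhds h)
  rw [eventually_nhdsWithin_iff] at h2
  filter_upwards [h2] with z hz hzS using hz ⟨hzS, mem_univ _⟩

theorem continuousOn_left (hF : ContinuousOn (fun z : ℝ × ℝ => F z.1 z.2) (S ×ˢ univ)) (p : ℝ) :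
    ContinuousOn (fun s => F s p) S :=
  hF.comp (f := fun s => (s, p)) (by fun_prop) fun _ hs => ⟨hs, mem_univ _⟩

theorem continuous_right (hF : ContinuousOn (fun z : ℝ × ℝ => F z.1 z.2) (S ×ˢ univ)) {s : ℝ}
    (hs : s ∈ S) : Continuous (F s) := by
  rw [← continuousOn_univ]
  exact hF.comp (f := fun p => (s, p)) (by fun_prop) fun _ _ => ⟨hs, mem_univ _⟩

/-- For parameters near `s₀`, the values at both ends `±R` of a fixed interval exceed the value at `0`
by more than `1`. -/
theorem eventually_add_one_lt (hF : ContinuousOn (fun z : ℝ × ℝ => F z.1 z.2) (S ×ˢ univ))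
    {s₀ : ℝ} (hs₀ : s₀ ∈ S) (hco : Tendsto (F s₀) (cocompact ℝ) atTop) :
    ∃ R > 0, ∀ᶠ s in 𝓝[S] s₀, F s 0 + 1 < F s R ∧ F s 0 + 1 < F s (-R) := by
  obtain ⟨R, hR, h1, h2⟩ := exists_add_one_lt hco
  refine ⟨R, hR, ?_⟩
  have c0 := continuousOn_left hF 0 s₀ hs₀
  have c1 := continuousOn_left hF R s₀ hs₀
  have c2 := continuousOn_left hF (-R) s₀ hs₀
  exact ((c0.add_const 1).eventually_lt c1 h1).and ((c0.add_const 1).eventually_lt c2 h2)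

/-- A strict lower bound, uniform in `p`, persists for nearby parameters: inside a large interval
by compactness, outside by convexity. -/
theorem eventually_forall_lt (hF : ContinuousOn (fun z : ℝ × ℝ => F z.1 z.2) (S ×ˢ univ))
    (hconv : ∀ s ∈ S, ConvexOn ℝ univ (F s)) {s₀ η : ℝ} (hs₀ : s₀ ∈ S)
    (hco : Tendsto (F s₀) (cocompact ℝ) atTop) (hη : ∀ p, η < F s₀ p) :
    ∀ᶠ s in 𝓝[S] s₀, ∀ p, η < F s p := by
  obtain ⟨R, hR, hR'⟩ := eventually_add_one_lt hF hs₀ hco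
  have h1 : ∀ᶠ s in 𝓝 s₀, ∀ p ∈ Icc (-R) R, s ∈ S → η < F s p := by
    refine isCompact_Icc.eventually_forall_of_forall_eventually fun p _ => ?_
    simpa only [nhds_prod_eq] using eventually_lt_of_continuousOn hF hs₀ (hη p)
  filter_upwards [hR', nhdsWithin_le_nhds h1, self_mem_nhdsWithin] with s hs h1 hsS p
  have h0 := h1 0 ⟨by linarith, hR.le⟩ hsS
  rcases le_or_gt p (-R) with hp | hp
  · have := (hconv s hsS).comp_neg_univ.add_mul_div_le (p := -p) (c := 0) hR (by linarith)
      (by simpa using (by linarith [hs.2] : F s 0 ≤ F s (-R)))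
    simp only [neg_zero, neg_neg, zero_mul, add_zero] at this
    linarith
  rcases le_or_gt p R with hp' | hp'
  · exact h1 p ⟨hp.le, hp'⟩ hsS
  · have := (hconv s hsS).add_mul_div_le (p := p) (c := 0) hR hp'.le (by linarith [hs.1])
    linarith

/-- Uniform linear growth of a family of convex coercive functions over a compact set. -/
theorem exists_forall_linear_growth (hS : IsCompact S)
    (hF : ContinuousOn (fun z : ℝ × ℝ => F z.1 z.2) (S ×ˢ univ))
    (hconv : ∀ s ∈ S, ConvexOn ℝ univ (F s))
    (hco : ∀ s ∈ S, Tendsto (F s) (cocompact ℝ) atTop) :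
    ∃ q > 0, ∃ M > 0, ∀ s ∈ S, ∀ p, q * |p| - M ≤ F s p := by
  have key : ∃ R > 0, ∀ s ∈ S, F s 0 + 1 ≤ F s R ∧ F s 0 + 1 ≤ F s (-R) := by
    have : ∃ R₀ > 0, ∀ R ≥ R₀, ∀ s ∈ S, F s 0 + 1 ≤ F s R ∧ F s 0 + 1 ≤ F s (-R) := by
      -- the clause `s ∈ S` makes the property local on neighbourhoods of points of `S`
      refine (hS.induction_on
        (p := fun T => ∃ R₀ > 0, ∀ R ≥ R₀, ∀ s ∈ T, s ∈ S →
          F s 0 + 1 ≤ F s R ∧ F s 0 + 1 ≤ F s (-R)) ⟨1, one_pos, by simp⟩ ?_ ?_ ?_).imp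
            fun R₀ h => ⟨h.1, fun R hR s hs => h.2 R hR s hs hs⟩
      · rintro T T' hT ⟨R₀, h0, h⟩
        exact ⟨R₀, h0, fun R hR s hs => h R hR s (hT hs)⟩
      · rintro T T' ⟨R, h0, h⟩ ⟨R', h0', h'⟩
        refine ⟨max R R', lt_max_of_lt_left h0, fun r hr s hs => ?_⟩
        rcases hs with hs | hs
        · exact h r (le_trans (le_max_left _ _) hr) s hs
        · exact h' r (le_trans (le_max_right _ _) hr) s hs
      · intro s hs
        obtain ⟨R, hR, hR'⟩ := eventually_add_one_lt hF hs (hco s hs)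
        refine ⟨_, hR', R, hR, fun r hr t ht htS => ?_⟩
        have hr0 : 1 ≤ r / R := (one_le_div hR).2 hr
        have e1 := (hconv t htS).add_mul_div_le (p := r) (c := 1) hR hr ht.1.le
        have e2 := (hconv t htS).comp_neg_univ.add_mul_div_le (p := r) (c := 1) hR hr
          (by simpa using ht.2.le)
        simp only [neg_zero] at e2
        constructor <;> linarith
    obtain ⟨R₀, h0, h⟩ := this
    exact ⟨R₀, h0, h R₀ le_rfl⟩
  obtain ⟨R, hR, h⟩ := key
  have hcpt : IsCompact (S ×ˢ Icc (-R) R) := hS.prod isCompact_Icc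
  obtain ⟨m, hm⟩ := (hcpt.image_of_continuousOn
    (hF.mono (prod_mono_right (subset_univ _)))).bddBelow
  have hm' : ∀ s ∈ S, ∀ p, |p| ≤ R → m ≤ F s p := fun s hs p hp =>
    hm ⟨(s, p), ⟨hs, abs_le.1 hp⟩, rfl⟩
  refine ⟨1 / R, by positivity, |m| + 1, by positivity, fun s hs p => ?_⟩
  have hm0 := hm' s hs 0 (by simpa using hR.le)
  have hma := neg_abs_le m
  rcases le_or_gt |p| R with hp | hp
  · have : 1 / R * |p| ≤ 1 := by rw [one_div, inv_mul_le_iff₀ hR]; linarith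
    linarith [hm' s hs p hp]
  · have e : F s 0 + 1 * (|p| / R) ≤ F s p := by
      rcases le_or_gt 0 p with h0 | h0
      · rw [abs_of_nonneg h0] at hp ⊢
        exact (hconv s hs).add_mul_div_le hR hp.le (h s hs).1
      · rw [abs_of_neg h0] at hp ⊢
        simpa using (hconv s hs).comp_neg_univ.add_mul_div_le (c := 1) hR hp.le
          (by simpa using (h s hs).2)
    have e2 : 1 / R * |p| = 1 * (|p| / R) := by ring
    linarith

theorem ConvexOn.exists_subgradient {f : ℝ → ℝ} (hf : ConvexOn ℝ univ f) (x : ℝ) :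
    ∃ q, ∀ y, f x + q * (y - x) ≤ f y := by
  refine ⟨derivWithin f (Ioi x) x, fun y => ?_⟩
  have hx : x ∈ interior (univ : Set ℝ) := by simp
  rcases lt_trichotomy x y with h | h | h
  · have := hf.rightDeriv_le_slope_of_mem_interior hx (mem_univ y) h
    rw [slope_def_field, le_div_iff₀ (by linarith)] at this
    linarith
  · simp [h]
  · have h1 := hf.slope_le_leftDeriv_of_mem_interior (mem_univ y) hx h
    have h2 := h1.trans (hf.leftDeriv_le_rightDeriv_of_mem_interior hx)
    rw [slope_def_field, div_le_iff₀ (by linarith)] at h2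
    nlinarith

/-- If `p` lies to the right of the sublevel set `{F s₀ ≤ 0}`, then some speed `q > 0` has
Lagrangian at most `p q` at all nearby points. -/
theorem eventually_lagrangian_le_of_gt
    (hF : ContinuousOn (fun z : ℝ × ℝ => F z.1 z.2) (S ×ˢ univ))
    (hconv : ∀ s ∈ S, ConvexOn ℝ univ (F s)) {s₀ p₀ p : ℝ} (hs₀ : s₀ ∈ S)
    (hco : Tendsto (F s₀) (cocompact ℝ) atTop) (hp₀ : F s₀ p₀ ≤ 0) (hp : 0 < F s₀ p)
    (hlt : p₀ < p) :
    ∃ q > 0, ∀ᶠ s in 𝓝[S] s₀, ∀ p', p' * q - F s p' ≤ p * q := by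
  have hcont := continuous_right hF hs₀
  obtain ⟨p₁, h1, ⟨h2, h3⟩⟩ : ∃ p₁, 0 < F s₀ p₁ ∧ p₁ ∈ Ioo p₀ p := by
    have e1 : ∀ᶠ x in 𝓝[<] p, 0 < F s₀ x :=
      nhdsWithin_le_nhds (hcont.continuousAt.eventually (lt_mem_nhds hp))
    exact (e1.and (Ioo_mem_nhdsLT hlt)).exists
  obtain ⟨q, hq⟩ := (hconv s₀ hs₀).exists_subgradient p₁
  have hq0 : 0 < q := by
    have := hq p₀
    by_contra hneg
    nlinarith [mul_nonneg_of_nonpos_of_nonpos (not_lt.1 hneg) (by linarith : p₀ - p₁ ≤ 0)]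
  obtain ⟨m, hm⟩ : ∃ m, ∀ p', m ≤ F s₀ p' := by
    obtain ⟨p', h'⟩ := hcont.exists_forall_le hco
    exact ⟨_, h'⟩
  -- lowering the slope `q` slightly keeps the inequality strict and makes the gap coercive
  set c := F s₀ p₁
  set ε := min (1 / 2) (c / (2 * (|m| + 1))) with hε
  have hεpos : 0 < ε := by positivity
  have hε1 : ε ≤ 1 / 2 := min_le_left _ _
  have hε2 : ε * (|m| + 1) ≤ c / 2 := by
    have : ε ≤ c / (2 * (|m| + 1)) := min_le_right _ _
    rw [le_div_iff₀ (by positivity)] at this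
    linarith
  set q' := (1 - ε) * q with hq'
  have hq'0 : 0 < q' := mul_pos (by linarith) hq0
  have low : ∀ p', ε * F s₀ p' + (1 - ε) * c ≤ F s₀ p' - q' * (p' - p) := by
    intro p'
    have e1 := mul_le_mul_of_nonneg_left (hq p') (by linarith : 0 ≤ 1 - ε)
    have e2 : 0 ≤ (1 - ε) * (q * (p - p₁)) :=
      mul_nonneg (by linarith) (mul_nonneg hq0.le (by linarith))
    have e3 : q' * (p' - p) = (1 - ε) * (q * (p' - p₁)) - (1 - ε) * (q * (p - p₁)) := by
      rw [hq']; ring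
    rw [mul_add] at e1
    rw [e3]
    linarith
  have hpos : ∀ p', 0 < F s₀ p' - q' * (p' - p) := by
    intro p'
    have e1 := mul_le_mul_of_nonneg_left (hm p') hεpos.le
    have e2 := mul_le_mul_of_nonneg_left (neg_abs_le m) hεpos.le
    nlinarith [low p']
  have hev := eventually_forall_lt (S := S) (F := fun s p' => F s p' - q' * (p' - p)) (s₀ := s₀)
    (η := 0) (hF.sub (by fun_prop)) (fun s hs => ?_) hs₀ ?_ hpos
  · refine ⟨q', hq'0, hev.mono fun s hs p' => ?_⟩
    nlinarith [hs p']
  · have : ConvexOn ℝ univ (fun p' : ℝ => -(q' * (p' - p))) :=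
      ⟨convex_univ, fun x _ y _ a b _ _ hab => by
        simp only [smul_eq_mul]
        apply le_of_eq
        linear_combination -(q' * p) * hab⟩
    exact (hconv s hs).add this
  · refine tendsto_atTop_mono low ?_
    exact tendsto_atTop_add_const_right _ _ (hco.const_mul_atTop hεpos)

/-- The mirror image of `eventually_lagrangian_le_of_gt`. -/
theorem eventually_lagrangian_le_of_lt
    (hF : ContinuousOn (fun z : ℝ × ℝ => F z.1 z.2) (S ×ˢ univ))
    (hconv : ∀ s ∈ S, ConvexOn ℝ univ (F s)) {s₀ p₀ p : ℝ} (hs₀ : s₀ ∈ S)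
    (hco : Tendsto (F s₀) (cocompact ℝ) atTop) (hp₀ : F s₀ p₀ ≤ 0) (hp : 0 < F s₀ p)
    (hlt : p < p₀) :
    ∃ q < 0, ∀ᶠ s in 𝓝[S] s₀, ∀ p', p' * q - F s p' ≤ p * q := by
  obtain ⟨q, hq, h⟩ := eventually_lagrangian_le_of_gt (S := S) (F := fun s p => F s (-p))
    (s₀ := s₀) (p₀ := -p₀) (p := -p)
    (hF.comp (f := fun z : ℝ × ℝ => (z.1, -z.2)) (by fun_prop) fun z hz => ⟨hz.1, mem_univ _⟩)
    (fun s hs => (hconv s hs).comp_neg_univ) hs₀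
    (hco.comp (Homeomorph.neg ℝ).isClosedEmbedding.tendsto_cocompact) (by simpa) (by simpa)
    (by linarith)
  refine ⟨-q, by linarith, h.mono fun s hs p' => ?_⟩
  have := hs (-p')
  simp only [neg_neg] at this
  linarith

end Family

/-! ### Topology of a network -/

namespace TopNetwork

variable {N : ℕ} {I J : Type*} (G : TopNetwork N I J)

theorem arc_mem (j : J) {s : ℝ} (hs : s ∈ Icc 0 (G.len j)) : G.arc j s ∈ G.closedEdge j :=
  mem_image_of_mem _ hs

theorem arc_mem_total (j : J) {s : ℝ} (hs : s ∈ Icc 0 (G.len j)) : G.arc j s ∈ G.total :=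
  mem_iUnion.2 ⟨j, G.arc_mem j hs⟩

theorem coord_arc (j : J) {s : ℝ} (hs : s ∈ Icc 0 (G.len j)) : G.coord j (G.arc j s) = s :=
  (G.arc_injective j).leftInvOn_invFunOn hs

theorem coord_mem {j : J} {x} (hx : x ∈ G.closedEdge j) : G.coord j x ∈ Icc 0 (G.len j) :=
  Function.invFunOn_mem hx

theorem arc_coord {j : J} {x} (hx : x ∈ G.closedEdge j) : G.arc j (G.coord j x) = x :=
  Function.invFunOn_eq hx

theorem arc_continuousOn (j : J) : ContinuousOn (G.arc j) (Icc 0 (G.len j)) :=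
  (G.arc_differentiable j).continuousOn

theorem zero_mem (j : J) : (0 : ℝ) ∈ Icc 0 (G.len j) := left_mem_Icc.2 (G.len_pos j).le

theorem len_mem (j : J) : G.len j ∈ Icc 0 (G.len j) := right_mem_Icc.2 (G.len_pos j).le

theorem eq_zero_or_eq_len {j : J} {s : ℝ} (hs : s ∈ Icc 0 (G.len j))
    (h : G.arc j s ∈ range G.vert) : s = 0 ∨ s = G.len j := by
  have hne : G.arc j 0 ≠ G.arc j (G.len j) := fun e =>
    (G.len_pos j).ne (G.arc_injective j (G.zero_mem j) (G.len_mem j) e)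
  have hfin : (G.arc j '' Icc 0 (G.len j) ∩ range G.vert).Finite :=
    finite_of_ncard_ne_zero (by rw [G.two_vertices j]; norm_num)
  have hsub : ({G.arc j 0, G.arc j (G.len j)} : Set _) ⊆
      G.arc j '' Icc 0 (G.len j) ∩ range G.vert := by
    rintro x (rfl | rfl)
    · exact ⟨G.arc_mem j (G.zero_mem j), G.arc_start j⟩
    · exact ⟨G.arc_mem j (G.len_mem j), G.arc_end j⟩
  have heq := eq_of_subset_of_ncard_le hsub
    (by rw [G.two_vertices j, ncard_pair hne]) hfin
  have hx : G.arc j s ∈ ({G.arc j 0, G.arc j (G.len j)} : Set _) := heq ▸ ⟨G.arc_mem j hs, h⟩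
  rcases hx with hx | hx
  · exact Or.inl (G.arc_injective j hs (G.zero_mem j) hx)
  · exact Or.inr (G.arc_injective j hs (G.len_mem j) hx)

theorem not_vert_of_mem_Ioo {j : J} {s : ℝ} (hs : s ∈ Ioo 0 (G.len j)) :
    G.arc j s ∉ range G.vert := fun h => by
  rcases G.eq_zero_or_eq_len (Ioo_subset_Icc_self hs) h with h | h
  · exact hs.1.ne' h
  · exact hs.2.ne h

theorem edge_unique {j k : J} {s : ℝ} (hs : s ∈ Ioo 0 (G.len j))
    (h : G.arc j s ∈ G.closedEdge k) : k = j := by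
  by_contra hne
  exact G.not_vert_of_mem_Ioo hs
    (G.inter_subset k j hne ⟨h, G.arc_mem j (Ioo_subset_Icc_self hs)⟩)

theorem bdry_subset_range : G.bdry ⊆ range G.vert := image_subset_range _ _

theorem arc_mem_inner {j : J} {s : ℝ} (hs : s ∈ Ioo 0 (G.len j)) : G.arc j s ∈ G.inner :=
  ⟨G.arc_mem_total j (Ioo_subset_Icc_self hs),
    fun h => G.not_vert_of_mem_Ioo hs (G.bdry_subset_range h)⟩

theorem exists_inc (i : I) : ∃ j, G.Inc i j := by
  obtain ⟨n, e, h, -⟩ := G.connected i i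
  exact ⟨_, h⟩

theorem vert_mem_total (i : I) : G.vert i ∈ G.total :=
  let ⟨j, hj⟩ := G.exists_inc i
  mem_iUnion.2 ⟨j, hj⟩

theorem vert_mem_inner {i : I} (hi : i ∉ G.bdryIdx) : G.vert i ∈ G.inner :=
  ⟨G.vert_mem_total i, fun ⟨_, h, e⟩ => hi (G.vert_injective e ▸ h)⟩

/-- A transition vertex has a second incident edge. -/
theorem exists_inc_ne {i : I} (hi : i ∉ G.bdryIdx) (j : J) : ∃ k, G.Inc i k ∧ k ≠ j := by
  by_contra! hcon
  obtain ⟨j', hj'⟩ := G.exists_inc i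
  obtain rfl := hcon j' hj'
  refine hi (G.bdryIdx_of_leaf i (ncard_eq_one.2 ⟨j', ?_⟩))
  exact Subset.antisymm (fun k hk => hcon k hk) (by rintro k rfl; exact hj')

theorem sgn_coord_cases {i : I} {j : J} (h : G.Inc i j) :
    (G.sgn i j = 1 ∧ G.coord j (G.vert i) = 0) ∨
      (G.sgn i j = -1 ∧ G.coord j (G.vert i) = G.len j) := by
  have hc := G.coord_mem h
  have ha := G.arc_coord h
  rcases G.eq_zero_or_eq_len hc (by rw [ha]; exact mem_range_self i) with h0 | h0
  · left
    rw [h0] at ha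
    exact ⟨by simp [sgn, ha], h0⟩
  · right
    rw [h0] at ha
    have : G.arc j 0 ≠ G.vert i := fun e => (G.len_pos j).ne
      (G.arc_injective j (G.zero_mem j) (G.len_mem j) (e.trans ha.symm))
    exact ⟨by simp [sgn, ha, this], h0⟩

theorem sgn_mul_self {i : I} {j : J} (h : G.Inc i j) : G.sgn i j * G.sgn i j = 1 := by
  rcases G.sgn_coord_cases h with h | h <;> simp [h.1]

theorem map_arc_nhdsWithin (j : J) {s : ℝ} (hs : s ∈ Icc 0 (G.len j)) :
    map (G.arc j) (𝓝[Icc 0 (G.len j)] s) = 𝓝[G.closedEdge j] (G.arc j s) := by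
  have hc : Continuous ((Icc 0 (G.len j)).domRestrict (G.arc j)) :=
    (G.arc_continuousOn j).domRestrict
  have he := (hc.isClosedEmbedding (injOn_iff_injective.1 (G.arc_injective j))).isEmbedding
  have h1 := he.map_nhds_eq ⟨s, hs⟩
  rw [range_domRestrict] at h1
  rw [nhdsWithin_eq_map_subtype_coe hs, map_map]
  exact h1

theorem isCompact_closedEdge (j : J) : IsCompact (G.closedEdge j) :=
  isCompact_Icc.image_of_continuousOn (G.arc_continuousOn j)

theorem isCompact_total [Finite J] : IsCompact G.total :=
  isCompact_iUnion fun j => G.isCompact_closedEdge j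

theorem isClosed_bdry [Finite I] : IsClosed G.bdry :=
  (toFinite G.bdryIdx |>.image _).isClosed

theorem eventually_total_iff [Finite J] {x} {P : EuclideanSpace ℝ (Fin N) → Prop} :
    (∀ᶠ z in 𝓝[G.total] x, P z) ↔ ∀ j, x ∈ G.closedEdge j →
      ∀ᶠ s in 𝓝[Icc 0 (G.len j)] (G.coord j x), P (G.arc j s) := by
  rw [total, nhdsWithin_iUnion, eventually_iSup]
  refine forall_congr' fun j => ⟨fun h hx => ?_, fun h => ?_⟩
  · rw [← G.arc_coord hx, ← G.map_arc_nhdsWithin j (G.coord_mem hx), eventually_map] at h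
    exact h
  · by_cases hx : x ∈ G.closedEdge j
    · rw [← G.arc_coord hx, ← G.map_arc_nhdsWithin j (G.coord_mem hx), eventually_map]
      exact h hx
    · have : 𝓝[G.closedEdge j] x = ⊥ := by
        rw [← not_neBot, ← mem_closure_iff_nhdsWithin_neBot,
          (G.isCompact_closedEdge j).isClosed.closure_eq]
        exact hx
      rw [this]
      exact eventually_bot

theorem nhdsWithin_inner [Finite I] {x} (hx : x ∈ G.inner) : 𝓝[G.inner] x = 𝓝[G.total] x := by
  rw [inner, sdiff_eq, nhdsWithin_inter_of_mem']
  exact mem_nhdsWithin_of_mem_nhds (G.isClosed_bdry.isOpen_compl.mem_nhds hx.2)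

theorem eventually_inner_iff [Finite I] [Finite J] {x} (hx : x ∈ G.inner)
    {P : EuclideanSpace ℝ (Fin N) → Prop} :
    (∀ᶠ z in 𝓝[G.inner] x, P z) ↔ ∀ j, x ∈ G.closedEdge j →
      ∀ᶠ s in 𝓝[Icc 0 (G.len j)] (G.coord j x), P (G.arc j s) := by
  rw [G.nhdsWithin_inner hx, G.eventually_total_iff]

theorem continuousOn_total_iff [Finite J] {F : EuclideanSpace ℝ (Fin N) → ℝ} :
    ContinuousOn F G.total ↔
      ∀ j, ContinuousOn (fun s => F (G.arc j s)) (Icc 0 (G.len j)) := by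
  refine ⟨fun h j => h.comp (G.arc_continuousOn j) fun s hs => G.arc_mem_total j hs, ?_⟩
  intro h x hx
  rw [ContinuousWithinAt, tendsto_def]
  intro U hU
  refine G.eventually_total_iff.2 fun j hj => ?_
  have := h j _ (G.coord_mem hj)
  rw [ContinuousWithinAt, G.arc_coord hj] at this
  exact this hU

open Classical in
/-- Functions on the edges that agree at common endpoints come from a function on the network. -/
theorem exists_glue (f : J → ℝ → ℝ)
    (hf : ∀ j k x, x ∈ G.closedEdge j → x ∈ G.closedEdge k →
      f j (G.coord j x) = f k (G.coord k x)) :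
    ∃ F : EuclideanSpace ℝ (Fin N) → ℝ, ∀ j, ∀ s ∈ Icc 0 (G.len j), F (G.arc j s) = f j s := by
  refine ⟨fun x => if h : ∃ j, x ∈ G.closedEdge j then f h.choose (G.coord h.choose x) else 0,
    fun j s hs => ?_⟩
  have h : ∃ k, G.arc j s ∈ G.closedEdge k := ⟨j, G.arc_mem j hs⟩
  simp only [h, dif_pos]
  rw [hf _ j _ h.choose_spec (G.arc_mem j hs), G.coord_arc j hs]

theorem exists_continuous_extension (j : J) {f : ℝ → ℝ} (hf : ContinuousOn f (Icc 0 (G.len j))) :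
    ∃ φ : EuclideanSpace ℝ (Fin N) → ℝ, Continuous φ ∧
      ∀ s ∈ Icc 0 (G.len j), φ (G.arc j s) = f s := by
  have hc : Continuous ((Icc 0 (G.len j)).domRestrict (G.arc j)) :=
    (G.arc_continuousOn j).domRestrict
  have he := hc.isClosedEmbedding (injOn_iff_injective.1 (G.arc_injective j))
  obtain ⟨φ, hφ⟩ := ContinuousMap.exists_extension' he ⟨_, hf.domRestrict⟩
  exact ⟨φ, φ.continuous, fun s hs => congrFun hφ ⟨s, hs⟩⟩

theorem edgeDeriv_eq {j : J} {φ : EuclideanSpace ℝ (Fin N) → ℝ} {x} (hx : x ∈ G.closedEdge j)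
    {p : ℝ} (h : HasDerivWithinAt (fun s => φ (G.arc j s)) p (Icc 0 (G.len j)) (G.coord j x)) :
    G.edgeDeriv j φ x = p :=
  h.derivWithin (uniqueDiffOn_Icc (G.len_pos j) _ (G.coord_mem hx))

variable {G}

/-- The subsolution test in the interior of an edge, for test functions given on that edge only. -/
theorem IsSubsolution.edge_test [Finite I] [Finite J] {H : J → ℝ → ℝ → ℝ} {Ω}
    {v : EuclideanSpace ℝ (Fin N) → ℝ} (hv : G.IsSubsolution H Ω v) {j : J} {s₀ p : ℝ}
    (hs₀ : s₀ ∈ Ioo 0 (G.len j)) (hΩ : G.arc j s₀ ∈ Ω) {f : ℝ → ℝ}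
    (hf : ContinuousOn f (Icc 0 (G.len j))) (hp : HasDerivAt f p s₀)
    (hmax : ∀ᶠ s in 𝓝 s₀, v (G.arc j s) - f s ≤ v (G.arc j s₀) - f s₀) : H j s₀ p ≤ 0 := by
  have hs := Ioo_subset_Icc_self hs₀
  obtain ⟨φ, hφ, hφf⟩ := G.exists_continuous_extension j hf
  have hx := G.arc_mem j hs
  have hco := G.coord_arc j hs
  have hd : HasDerivWithinAt (fun s => φ (G.arc j s)) p (Icc 0 (G.len j))
      (G.coord j (G.arc j s₀)) := by
    rw [hco]
    exact hp.hasDerivWithinAt.congr_of_mem hφf hs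
  have := hv.2.1 j _ ⟨s₀, hs₀, rfl⟩ hΩ φ hφ.continuousOn hd.differentiableWithinAt ?_
  · rwa [hco, G.edgeDeriv_eq hx hd] at this
  · refine (G.eventually_inner_iff (G.arc_mem_inner hs₀)).2 fun k hk => ?_
    obtain rfl := G.edge_unique hs₀ hk
    rw [hco]
    filter_upwards [nhdsWithin_le_nhds hmax, self_mem_nhdsWithin] with s h1 h2
    rw [hφf s h2, hφf s₀ hs]
    exact h1

end TopNetwork

/-! ### The Lagrangian, extended integrals, and the action of paths -/

theorem lagrangian_le_iff {h : ℝ → ℝ} {q M : ℝ} :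
    lagrangian h q ≤ (M : EReal) ↔ ∀ p, p * q - h p ≤ M := by
  simp only [lagrangian, iSup_le_iff, EReal.coe_le_coe_iff]

theorem le_lagrangian (h : ℝ → ℝ) (q p : ℝ) : ((p * q - h p : ℝ) : EReal) ≤ lagrangian h q :=
  le_iSup (fun p : ℝ => ((p * q - h p : ℝ) : EReal)) p

theorem erealIntegral_mono {s : Set ℝ} {f g : ℝ → EReal}
    (h : ∀ᵐ r ∂volume.restrict s, f r ≤ g r) : erealIntegral s f ≤ erealIntegral s g := by
  refine EReal.sub_le_sub ?_ ?_
  · exact EReal.coe_ennreal_le_coe_ennreal_iff.2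
      (lintegral_mono_ae (h.mono fun r hr => EReal.toENNReal_le_toENNReal hr))
  · exact EReal.coe_ennreal_le_coe_ennreal_iff.2
      (lintegral_mono_ae (h.mono fun r hr =>
        EReal.toENNReal_le_toENNReal (EReal.neg_le_neg_iff.2 hr)))

theorem erealIntegral_congr {s : Set ℝ} (hs : MeasurableSet s) {f g : ℝ → EReal}
    (h : ∀ r ∈ s, f r = g r) : erealIntegral s f = erealIntegral s g :=
  le_antisymm
    (erealIntegral_mono ((ae_restrict_iff' hs).2 (ae_of_all _ fun r hr => (h r hr).le)))
    (erealIntegral_mono ((ae_restrict_iff' hs).2 (ae_of_all _ fun r hr => (h r hr).ge)))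

theorem erealIntegral_coe {s : Set ℝ} {φ : ℝ → ℝ} (hφ : IntegrableOn φ s) :
    erealIntegral s (fun r => (φ r : EReal)) = ((∫ r in s, φ r : ℝ) : EReal) := by
  have h1 : ∫⁻ r in s, ENNReal.ofReal (φ r) ≠ ⊤ :=
    hφ.lintegral_lt_top.ne
  have h2 : ∫⁻ r in s, ENNReal.ofReal (-φ r) ≠ ⊤ :=
    hφ.neg.lintegral_lt_top.ne
  rw [integral_eq_lintegral_pos_part_sub_lintegral_neg_part hφ, EReal.coe_sub,
    EReal.coe_ennreal_toReal h1, EReal.coe_ennreal_toReal h2]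
  simp only [erealIntegral, ← EReal.coe_neg, EReal.toENNReal_of_ne_top (EReal.coe_ne_top _), EReal.toReal_coe]

theorem erealIntegral_add_left (T a b : ℝ) (f : ℝ → EReal) :
    erealIntegral (Ioo (T + a) (T + b)) f = erealIntegral (Ioo a b) fun r => f (T + r) := by
  have key : ∀ g : ℝ → ENNReal, ∫⁻ r in Ioo (T + a) (T + b), g r = ∫⁻ r in Ioo a b, g (T + r) := by
    intro g
    rw [← (measurePreserving_add_left volume T).setLIntegral_comp_preimage_emb
      (MeasurableEquiv.addLeft T).measurableEmbedding]
    congr 2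
    ext r
    simp
  simp only [erealIntegral, key]

namespace TopNetwork

variable {N : ℕ} {I J : Type*} {G : TopNetwork N I J}

namespace NetPath

theorem τ_nonneg {y x} (c : G.NetPath y x) (i : Fin (c.n + 2)) : 0 ≤ c.τ i :=
  c.τ_zero ▸ c.τ_strictMono.monotone (Fin.zero_le i)

theorem τ_le_last {y x} (c : G.NetPath y x) (i : Fin (c.n + 2)) :
    c.τ i ≤ c.τ (Fin.last (c.n + 1)) := c.τ_strictMono.monotone (Fin.le_last i)

/-- The partition of the concatenation of two paths. -/
noncomputable def concatτ {y x z} (c₁ : G.NetPath y x) (c₂ : G.NetPath x z)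
    (i : Fin (c₁.n + 1 + c₂.n + 2)) : ℝ :=
  if h : i.1 < c₁.n + 2 then c₁.τ ⟨i, h⟩
  else c₁.τ (Fin.last (c₁.n + 1)) + c₂.τ ⟨i - (c₁.n + 1), by omega⟩

variable {y x z : EuclideanSpace ℝ (Fin N)} (c₁ : G.NetPath y x) (c₂ : G.NetPath x z)

theorem concatτ_left (k : ℕ) (h : k < c₁.n + 2) (h') :
    concatτ c₁ c₂ ⟨k, h'⟩ = c₁.τ ⟨k, h⟩ := by simp [concatτ, h]

theorem concatτ_right (k : ℕ) (h : k < c₂.n + 2) (h') :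
    concatτ c₁ c₂ ⟨c₁.n + 1 + k, h'⟩ = c₁.τ (Fin.last (c₁.n + 1)) + c₂.τ ⟨k, h⟩ := by
  rcases Nat.eq_zero_or_pos k with rfl | hk
  · have : c₂.τ ⟨0, h⟩ = 0 := c₂.τ_zero
    refine (concatτ_left c₁ c₂ (c₁.n + 1 + 0) (by omega) h').trans ?_
    rw [this]
    exact (add_zero _).symm
  · have : ¬ c₁.n + 1 + k < c₁.n + 2 := by omega
    simp [concatτ, this]

/-- The curve of the concatenation of two paths. -/
noncomputable def concatγ (t : ℝ) : EuclideanSpace ℝ (Fin N) :=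
  if t ≤ c₁.τ (Fin.last (c₁.n + 1)) then c₁.γ t else c₂.γ (t - c₁.τ (Fin.last (c₁.n + 1)))

theorem concatγ_left {t : ℝ} (ht : t ≤ c₁.τ (Fin.last (c₁.n + 1))) :
    concatγ c₁ c₂ t = c₁.γ t := if_pos ht

theorem concatγ_right {t : ℝ} (ht : 0 ≤ t) :
    concatγ c₁ c₂ (c₁.τ (Fin.last (c₁.n + 1)) + t) = c₂.γ t := by
  rcases ht.eq_or_lt with rfl | ht
  · rw [add_zero, concatγ_left c₁ c₂ le_rfl, c₁.end_eq, c₂.start_eq]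
  · have : ¬ c₁.τ (Fin.last (c₁.n + 1)) + t ≤ c₁.τ (Fin.last (c₁.n + 1)) := by linarith
    simp [concatγ, this]

theorem concat_cases {P : Fin (c₁.n + 1 + c₂.n + 1) → Prop}
    (h1 : ∀ m : Fin (c₁.n + 1), P (Fin.castAdd (c₂.n + 1) m))
    (h2 : ∀ m : Fin (c₂.n + 1), P (Fin.natAdd (c₁.n + 1) m)) (m) : P m :=
  Fin.addCases (m := c₁.n + 1) (n := c₂.n + 1) (motive := P) h1 h2 m

theorem concatτ_castAdd (m : Fin (c₁.n + 1)) :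
    concatτ c₁ c₂ (Fin.castSucc (n := c₁.n + 1 + c₂.n + 1) (Fin.castAdd (c₂.n + 1) m)) =
        c₁.τ m.castSucc ∧
      concatτ c₁ c₂ (Fin.succ (n := c₁.n + 1 + c₂.n + 1) (Fin.castAdd (c₂.n + 1) m)) =
        c₁.τ m.succ :=
  ⟨concatτ_left c₁ c₂ m.1 (by omega) _, concatτ_left c₁ c₂ (m.1 + 1) (by omega) _⟩

theorem concatτ_natAdd (m : Fin (c₂.n + 1)) :
    concatτ c₁ c₂ (Fin.castSucc (n := c₁.n + 1 + c₂.n + 1) (Fin.natAdd (c₁.n + 1) m)) =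
        c₁.τ (Fin.last (c₁.n + 1)) + c₂.τ m.castSucc ∧
      concatτ c₁ c₂ (Fin.succ (n := c₁.n + 1 + c₂.n + 1) (Fin.natAdd (c₁.n + 1) m)) =
        c₁.τ (Fin.last (c₁.n + 1)) + c₂.τ m.succ :=
  ⟨concatτ_right c₁ c₂ m.1 (by omega) _, concatτ_right c₁ c₂ (m.1 + 1) (by omega) _⟩

/-- Concatenation of paths. -/
noncomputable def concat : G.NetPath y z where
  n := c₁.n + 1 + c₂.n
  τ := concatτ c₁ c₂
  edge := Fin.append (m := c₁.n + 1) (n := c₂.n + 1) c₁.edge c₂.edge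
  γ := concatγ c₁ c₂
  τ_zero := (concatτ_left c₁ c₂ 0 (by omega) _).trans c₁.τ_zero
  τ_strictMono := by
    refine Fin.strictMono_iff_lt_succ.2 (concat_cases c₁ c₂ (fun m => ?_) fun m => ?_)
    · rw [(concatτ_castAdd c₁ c₂ m).1, (concatτ_castAdd c₁ c₂ m).2]
      exact c₁.τ_strictMono Fin.castSucc_lt_succ
    · rw [(concatτ_natAdd c₁ c₂ m).1, (concatτ_natAdd c₁ c₂ m).2]
      exact add_lt_add_right (c₂.τ_strictMono Fin.castSucc_lt_succ) _
  continuousOn := by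
    have hlast : concatτ c₁ c₂ (Fin.last (c₁.n + 1 + c₂.n + 1)) =
        c₁.τ (Fin.last (c₁.n + 1)) + c₂.τ (Fin.last (c₂.n + 1)) :=
      concatτ_right c₁ c₂ (c₂.n + 1) (by omega) _
    rw [hlast]
    set T := c₁.τ (Fin.last (c₁.n + 1)) with hT
    have h1 := c₁.τ_nonneg (Fin.last _)
    have h2 := c₂.τ_nonneg (Fin.last _)
    rw [← Icc_union_Icc_eq_Icc h1 (by linarith)]
    refine ContinuousOn.union_of_isClosed ?_ ?_ isClosed_Icc isClosed_Icc
    · exact c₁.continuousOn.congr fun t ht => concatγ_left c₁ c₂ ht.2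
    · have : ContinuousOn (fun t => c₂.γ (t - T))
          (Icc T (T + c₂.τ (Fin.last (c₂.n + 1)))) :=
        c₂.continuousOn.comp (by fun_prop) fun t ht =>
          ⟨by linarith [ht.1], by linarith [ht.2]⟩
      refine this.congr fun t ht => ?_
      have := concatγ_right c₁ c₂ (t := t - T) (by linarith [ht.1])
      rwa [← hT, add_sub_cancel] at this
  mem_edge := by
    refine concat_cases c₁ c₂ (fun m => ?_) fun m => ?_
    · rw [(concatτ_castAdd c₁ c₂ m).1, (concatτ_castAdd c₁ c₂ m).2, Fin.append_left]
      intro s hs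
      rw [concatγ_left c₁ c₂ (hs.2.trans (c₁.τ_le_last _))]
      exact c₁.mem_edge m s hs
    · rw [(concatτ_natAdd c₁ c₂ m).1, (concatτ_natAdd c₁ c₂ m).2, Fin.append_right]
      intro s hs
      have h0 := c₂.τ_nonneg m.castSucc
      have := concatγ_right c₁ c₂ (t := s - c₁.τ (Fin.last (c₁.n + 1))) (by linarith [hs.1])
      rw [add_sub_cancel] at this
      rw [this]
      exact c₂.mem_edge m _ ⟨by linarith [hs.1], by linarith [hs.2]⟩
  contDiffOn := by
    refine concat_cases c₁ c₂ (fun m => ?_) fun m => ?_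
    · rw [(concatτ_castAdd c₁ c₂ m).1, (concatτ_castAdd c₁ c₂ m).2, Fin.append_left]
      refine (c₁.contDiffOn m).congr fun s hs => ?_
      rw [concatγ_left c₁ c₂ (hs.2.le.trans (c₁.τ_le_last _))]
    · rw [(concatτ_natAdd c₁ c₂ m).1, (concatτ_natAdd c₁ c₂ m).2, Fin.append_right]
      have h0 := c₂.τ_nonneg m.castSucc
      have h1 : ContDiffOn ℝ 1
          (fun s => G.coord (c₂.edge m) (c₂.γ (s - c₁.τ (Fin.last (c₁.n + 1)))))
          (Ioo (c₁.τ (Fin.last (c₁.n + 1)) + c₂.τ m.castSucc)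
            (c₁.τ (Fin.last (c₁.n + 1)) + c₂.τ m.succ)) :=
        (c₂.contDiffOn m).comp (f := fun s => s - c₁.τ (Fin.last (c₁.n + 1)))
          (by fun_prop) fun s hs => ⟨by linarith [hs.1], by linarith [hs.2]⟩
      refine h1.congr fun s hs => ?_
      have := concatγ_right c₁ c₂ (t := s - c₁.τ (Fin.last (c₁.n + 1))) (by linarith [hs.1])
      rw [add_sub_cancel] at this
      rw [this]
  start_eq := (concatγ_left c₁ c₂ (c₁.τ_nonneg _)).trans c₁.start_eq
  end_eq := by
    have hlast : concatτ c₁ c₂ (Fin.last (c₁.n + 1 + c₂.n + 1)) =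
        c₁.τ (Fin.last (c₁.n + 1)) + c₂.τ (Fin.last (c₂.n + 1)) :=
      concatτ_right c₁ c₂ (c₂.n + 1) (by omega) _
    rw [hlast, concatγ_right c₁ c₂ (c₂.τ_nonneg _), c₂.end_eq]

theorem action_concat (H : J → ℝ → ℝ → ℝ) :
    (c₁.concat c₂).action H = c₁.action H + c₂.action H := by
  unfold action
  refine (Fin.sum_univ_add (a := c₁.n + 1) (b := c₂.n + 1) _).trans ?_
  congr 1
  · refine Finset.sum_congr rfl fun m _ => ?_
    simp only [concat, (concatτ_castAdd c₁ c₂ m).1, (concatτ_castAdd c₁ c₂ m).2, Fin.append_left]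
    refine erealIntegral_congr measurableSet_Ioo fun s hs => ?_
    have hle : ∀ r ∈ Ioo (c₁.τ m.castSucc) (c₁.τ m.succ), concatγ c₁ c₂ r = c₁.γ r :=
      fun r hr => concatγ_left c₁ c₂ (hr.2.le.trans (c₁.τ_le_last _))
    rw [hle s hs]
    congr 1
    refine EventuallyEq.deriv_eq ?_
    filter_upwards [isOpen_Ioo.mem_nhds hs] with r hr
    rw [hle r hr]
  · refine Finset.sum_congr rfl fun m _ => ?_
    simp only [concat, (concatτ_natAdd c₁ c₂ m).1, (concatτ_natAdd c₁ c₂ m).2, Fin.append_right]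
    rw [erealIntegral_add_left]
    refine erealIntegral_congr measurableSet_Ioo fun s hs => ?_
    have h0 := c₂.τ_nonneg m.castSucc
    have hle : ∀ r ∈ Ioo (c₂.τ m.castSucc) (c₂.τ m.succ),
        concatγ c₁ c₂ (c₁.τ (Fin.last (c₁.n + 1)) + r) = c₂.γ r :=
      fun r hr => concatγ_right c₁ c₂ (h0.trans hr.1.le)
    rw [hle s hs]
    congr 1
    rw [← deriv_comp_const_add]
    refine EventuallyEq.deriv_eq ?_
    filter_upwards [isOpen_Ioo.mem_nhds hs] with r hr
    rw [hle r hr]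

end NetPath

variable (G)

/-- The path that moves with constant speed `q` along the edge `j`, starting at the parameter
`s`. -/
noncomputable def segment (j : J) (s q T : ℝ) (hT : 0 < T)
    (h : ∀ t ∈ Icc 0 T, s + q * t ∈ Icc 0 (G.len j)) :
    G.NetPath (G.arc j s) (G.arc j (s + q * T)) where
  n := 0
  τ := ![0, T]
  edge := fun _ => j
  γ := fun t => G.arc j (s + q * t)
  τ_zero := rfl
  τ_strictMono := by
    refine Fin.strictMono_iff_lt_succ.2 fun i => ?_
    fin_cases i
    simp [hT]
  continuousOn := (G.arc_continuousOn j).comp (by fun_prop) h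
  mem_edge := by
    intro m t ht
    fin_cases m
    exact G.arc_mem j (h t ht)
  contDiffOn := by
    intro m
    fin_cases m
    have : ContDiffOn ℝ 1 (fun t : ℝ => s + q * t) (Ioo 0 T) := by fun_prop
    exact this.congr fun t ht => G.coord_arc j (h t (Ioo_subset_Icc_self ht))
  start_eq := by simp
  end_eq := rfl

theorem segment_action_le (H : J → ℝ → ℝ → ℝ) {j : J} {s q T M : ℝ} (hT : 0 < T)
    (h : ∀ t ∈ Icc 0 T, s + q * t ∈ Icc 0 (G.len j))
    (hM : ∀ t ∈ Ioo 0 T, ∀ p, p * q - H j (s + q * t) p ≤ M) :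
    (G.segment j s q T hT h).action H ≤ ((T * M : ℝ) : EReal) := by
  have e : (G.segment j s q T hT h).action H = erealIntegral (Ioo 0 T) fun t =>
      lagrangian (H j (G.coord j (G.arc j (s + q * t))))
        (deriv (fun t => G.coord j (G.arc j (s + q * t))) t) :=
    Fin.sum_univ_one _
  have hint : IntegrableOn (fun _ : ℝ => M) (Ioo 0 T) := by simp
  have e2 : ∫ _ in Ioo 0 T, M = T * M := by simp [hT.le]
  rw [e, ← e2, ← erealIntegral_coe hint]
  refine erealIntegral_mono ((ae_restrict_iff' measurableSet_Ioo).2 (ae_of_all _ fun t ht => ?_))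
  rw [G.coord_arc j (h t (Ioo_subset_Icc_self ht))]
  have hd : deriv (fun t => G.coord j (G.arc j (s + q * t))) t = q := by
    have : (fun t => G.coord j (G.arc j (s + q * t))) =ᶠ[𝓝 t] fun t => s + q * t := by
      filter_upwards [isOpen_Ioo.mem_nhds ht] with r hr
      exact G.coord_arc j (h r (Ioo_subset_Icc_self hr))
    rw [this.deriv_eq]
    simp
  rw [hd]
  exact lagrangian_le_iff.2 (hM t ht)

theorem dist_le_of_speed (H : J → ℝ → ℝ → ℝ) {j : J} {s q T M : ℝ} (hT : 0 < T)
    (h : ∀ t ∈ Icc 0 T, s + q * t ∈ Icc 0 (G.len j))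
    (hM : ∀ t ∈ Ioo 0 T, ∀ p, p * q - H j (s + q * t) p ≤ M) :
    G.dist H (G.arc j s) (G.arc j (s + q * T)) ≤ ((T * M : ℝ) : EReal) :=
  (iInf_le _ _).trans (G.segment_action_le H hT h hM)

/-- If the speed `q ≠ 0` has Lagrangian at most `p q` between the parameters `s₁` and `s₂`, then
moving from `s₁` to `s₂` with this speed costs at most `p (s₂ - s₁)`. -/
theorem dist_arc_le_mul (H : J → ℝ → ℝ → ℝ) {j : J} {s₁ s₂ p q : ℝ}
    (h₁ : s₁ ∈ Icc 0 (G.len j)) (h₂ : s₂ ∈ Icc 0 (G.len j)) (hq : 0 < q * (s₂ - s₁))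
    (h : ∀ s ∈ uIcc s₁ s₂, ∀ p', p' * q - H j s p' ≤ p * q) :
    G.dist H (G.arc j s₁) (G.arc j s₂) ≤ ((p * (s₂ - s₁) : ℝ) : EReal) := by
  have hq0 : q ≠ 0 := by rintro rfl; simp at hq
  have hT : 0 < (s₂ - s₁) / q := by
    have : (s₂ - s₁) / q = q * (s₂ - s₁) / (q * q) := by field_simp
    rw [this]
    exact div_pos hq (mul_self_pos.2 hq0)
  have hmem : ∀ t ∈ Icc 0 ((s₂ - s₁) / q), s₁ + q * t ∈ uIcc s₁ s₂ := by
    rintro t ⟨ht0, ht1⟩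
    rcases lt_or_gt_of_ne hq0 with hneg | hpos
    · have h3 : s₂ - s₁ ≤ q * t := by
        rw [le_div_iff_of_neg hneg] at ht1; linarith
      have h4 : q * t ≤ 0 := mul_nonpos_of_nonpos_of_nonneg hneg.le ht0
      rw [uIcc_of_ge (by linarith)]
      exact ⟨by linarith, by linarith⟩
    · have h3 : q * t ≤ s₂ - s₁ := by
        rw [le_div_iff₀ hpos] at ht1; linarith
      have h4 : 0 ≤ q * t := mul_nonneg hpos.le ht0
      rw [uIcc_of_le (by linarith)]
      exact ⟨by linarith, by linarith⟩
  have := G.dist_le_of_speed H (M := p * q) hT (fun t ht => uIcc_subset_Icc h₁ h₂ (hmem t ht))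
    (fun t ht => h _ (hmem t (Ioo_subset_Icc_self ht)))
  rwa [mul_div_cancel₀ _ hq0, add_sub_cancel,
    show (s₂ - s₁) / q * (p * q) = p * (s₂ - s₁) by field_simp] at this

theorem exists_action_lt {H : J → ℝ → ℝ → ℝ} {y x : EuclideanSpace ℝ (Fin N)} {a : EReal}
    (h : G.dist H y x < a) : ∃ c : G.NetPath y x, c.action H < a := iInf_lt_iff.1 h

/-- The triangle inequality, stated with finite upper bounds to avoid sums `⊤ + ⊥`. -/
theorem dist_triangle_of_le {H : J → ℝ → ℝ → ℝ} {y x z : EuclideanSpace ℝ (Fin N)} {a b : ℝ}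
    (h1 : G.dist H y x ≤ a) (h2 : G.dist H x z ≤ b) : G.dist H y z ≤ ((a + b : ℝ) : EReal) := by
  refine EReal.le_of_forall_lt_iff_le.1 fun r hr => ?_
  have hr' : a + b < r := EReal.coe_lt_coe_iff.1 hr
  obtain ⟨c₁, hc₁⟩ := G.exists_action_lt
    (h1.trans_lt (EReal.coe_lt_coe_iff.2 (by linarith : a < a + (r - (a + b)) / 2)))
  obtain ⟨c₂, hc₂⟩ := G.exists_action_lt
    (h2.trans_lt (EReal.coe_lt_coe_iff.2 (by linarith : b < b + (r - (a + b)) / 2)))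
  refine (iInf_le _ (c₁.concat c₂)).trans ?_
  rw [NetPath.action_concat]
  refine (add_le_add hc₁.le hc₂.le).trans ?_
  rw [← EReal.coe_add, EReal.coe_le_coe_iff]
  linarith

end TopNetwork

/-! ### Continuous subsolutions: Lipschitz bound and comparison with the action -/

/-- One-sided slope bound from viscosity tests. The test functions `M s + c ((s - s₁)/(s₂ - s₁))^n`
have slope at least `M` on the right of `s₁`; for large `n` they force an interior maximum. -/
theorem sub_le_of_tests {l M : ℝ} {V : ℝ → ℝ} (hV : ContinuousOn V (Icc 0 l))
    (h : ∀ (f : ℝ → ℝ) (p s₀ : ℝ), s₀ ∈ Ioo 0 l → Continuous f → HasDerivAt f p s₀ →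
      (∀ᶠ s in 𝓝 s₀, V s - f s ≤ V s₀ - f s₀) → p < M) {s₁ s₂ : ℝ} (h1 : 0 ≤ s₁) (h12 : s₁ < s₂)
    (h2 : s₂ < l) : V s₂ - V s₁ ≤ M * (s₂ - s₁) := by
  by_contra! hcon
  have hd : 0 < s₂ - s₁ := by linarith
  set c := (V s₂ - V s₁ - M * (s₂ - s₁)) / 2 with hc
  have hc0 : 0 < c := by rw [hc]; linarith
  have hr : 1 < (l - s₁) / (s₂ - s₁) := (one_lt_div hd).2 (by linarith)
  obtain ⟨n, hn⟩ := pow_unbounded_of_one_lt ((V l - M * l - (V s₂ - M * s₂ - c)) / c) hr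
  obtain ⟨m, hm, hmn⟩ : ∃ m, m ≠ 0 ∧ (V l - M * l - (V s₂ - M * s₂ - c)) / c <
      ((l - s₁) / (s₂ - s₁)) ^ m :=
    ⟨n + 1, by omega, hn.trans (pow_lt_pow_right₀ hr (by omega))⟩
  rw [div_lt_iff₀ hc0] at hmn
  set f : ℝ → ℝ := fun s => M * s + c * ((s - s₁) / (s₂ - s₁)) ^ m with hf
  have hfc : Continuous f := by fun_prop
  obtain ⟨s₀, hs₀, hmax⟩ := isCompact_Icc.exists_isMaxOn (nonempty_Icc.2 (h12.trans h2).le)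
    ((hV.sub hfc.continuousOn).mono (Icc_subset_Icc_left h1))
  have hmax2 := hmax (⟨h12.le, h2.le⟩ : s₂ ∈ Icc s₁ l)
  simp only [mem_ofPred_eq, Pi.sub_apply] at hmax2
  have hf2 : f s₂ = M * s₂ + c := by simp [hf, div_self hd.ne']
  have hne1 : s₁ ≠ s₀ := by
    rintro rfl
    have hf1 : f s₁ = M * s₁ := by simp [hf, hm]
    rw [hf1, hf2] at hmax2
    linarith
  have hne2 : s₀ ≠ l := by
    rintro rfl
    rw [hf2] at hmax2
    simp only [hf] at hmax2
    linarith
  have hs1 : s₁ < s₀ := lt_of_le_of_ne hs₀.1 hne1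
  have hs2 : s₀ < l := lt_of_le_of_ne hs₀.2 hne2
  have hder : HasDerivAt f (M * 1 +
      c * (m * ((s₀ - s₁) / (s₂ - s₁)) ^ (m - 1) * (1 / (s₂ - s₁)))) s₀ :=
    ((hasDerivAt_id s₀).const_mul M).add
      (((((hasDerivAt_id s₀).sub_const s₁).div_const (s₂ - s₁)).pow m).const_mul c)
  have := h f _ s₀ ⟨by linarith, hs2⟩ hfc hder (by
    filter_upwards [Icc_mem_nhds hs1 hs2] with s hs using hmax hs)
  have hnn : 0 ≤ c * (m * ((s₀ - s₁) / (s₂ - s₁)) ^ (m - 1) * (1 / (s₂ - s₁))) := by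
    have : 0 ≤ (s₀ - s₁) / (s₂ - s₁) := div_nonneg (by linarith) hd.le
    positivity
  linarith

theorem lipschitzOnWith_of_tests {l : ℝ} {M : NNReal} {V : ℝ → ℝ} (hV : ContinuousOn V (Icc 0 l))
    (h : ∀ (f : ℝ → ℝ) (p s₀ : ℝ), s₀ ∈ Ioo 0 l → Continuous f → HasDerivAt f p s₀ →
      (∀ᶠ s in 𝓝 s₀, V s - f s ≤ V s₀ - f s₀) → |p| < M) : LipschitzOnWith M V (Icc 0 l) := by
  have key : LipschitzOnWith M V (Ioo 0 l) := by
    refine LipschitzOnWith.of_le_add_mul _ fun x hx y hy => ?_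
    rcases lt_trichotomy x y with hxy | rfl | hxy
    · -- the bound for decreasing arguments is the bound for the reflected function
      have := sub_le_of_tests (l := l) (M := M) (V := fun s => V (l - s)) (s₁ := l - y)
        (s₂ := l - x) (hV.comp (by fun_prop) fun s hs => ⟨by linarith [hs.2], by linarith [hs.1]⟩)
        (fun f p s₀ hs₀ hf hp hmax => ?_) (by linarith [hy.2]) (by linarith) (by linarith [hx.1])
      · simp only [sub_sub_cancel] at this
        rw [Real.dist_eq, abs_of_neg (by linarith)]
        linarith
      · have hp' : HasDerivAt (fun s => f (l - s)) (-p) (l - s₀) := by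
          have e : HasDerivAt (fun s : ℝ => l - s) (-1) (l - s₀) := by
            simpa using (hasDerivAt_id (l - s₀)).const_sub l
          have e' : HasDerivAt f p (l - (l - s₀)) := by rwa [sub_sub_cancel]
          have e'' := HasDerivAt.comp (l - s₀) e' e
          rwa [mul_neg_one] at e''
        have := h (fun s => f (l - s)) (-p) (l - s₀) ⟨by linarith [hs₀.2], by linarith [hs₀.1]⟩
          (by fun_prop) hp' ?_
        · rw [abs_neg] at this
          exact (le_abs_self p).trans_lt this
        · have ht : Tendsto (fun s => l - s) (𝓝 (l - s₀)) (𝓝 s₀) := by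
            have : Continuous fun s : ℝ => l - s := by fun_prop
            simpa using this.tendsto (l - s₀)
          filter_upwards [ht.eventually hmax] with s hs
          simpa using hs
    · simp
    · have := sub_le_of_tests (M := M) hV (fun f p s₀ hs₀ hf hp hmax =>
        (le_abs_self p).trans_lt (h f p s₀ hs₀ hf hp hmax)) hy.1.le hxy hx.2
      rw [Real.dist_eq, abs_of_pos (by linarith)]
      linarith
  rcases lt_or_ge 0 l with hl | hl
  · have := key.closure (by rwa [closure_Ioo hl.ne])
    rwa [closure_Ioo hl.ne] at this
  · have : (Icc 0 l).Subsingleton := fun x hx y hy => by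
      linarith [hx.1, hx.2, hy.1, hy.2]
    exact LipschitzOnWith.of_dist_le_mul fun x hx y hy => by simp [this hx hy]

namespace TopNetwork

variable {N : ℕ} {I J : Type*} {G : TopNetwork N I J}

section

variable {H : J → ℝ → ℝ → ℝ}

theorem IsEikonal.exists_growth (hH : G.IsEikonal H) (j : J) :
    ∃ q > 0, ∃ M > 0, ∀ s ∈ Icc 0 (G.len j), ∀ p, q * |p| - M ≤ H j s p :=
  exists_forall_linear_growth isCompact_Icc (hH.continuous j) (hH.convex j) (hH.coercive j)

variable [Finite I] [Finite J] {v : EuclideanSpace ℝ (Fin N) → ℝ}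

theorem IsSubsolution.exists_lipschitzOnWith (hH : G.IsEikonal H) (hvc : ContinuousOn v G.total)
    (hv : G.IsSubsolution H G.inner v) (j : J) :
    ∃ C, LipschitzOnWith C (fun s => v (G.arc j s)) (Icc 0 (G.len j)) := by
  obtain ⟨q, hq, M, hM, h⟩ := hH.exists_growth j
  refine ⟨⟨(M + 1) / q, by positivity⟩, lipschitzOnWith_of_tests
    (G.continuousOn_total_iff.1 hvc j) fun f p s₀ hs₀ hf hp hmax => ?_⟩
  have h1 := hv.edge_test hs₀ (G.arc_mem_inner hs₀) hf.continuousOn hp hmax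
  have h2 := h s₀ (Ioo_subset_Icc_self hs₀) p
  change |p| < (M + 1) / q
  rw [lt_div_iff₀ hq]
  linarith

theorem IsSubsolution.le_zero_of_hasDerivAt (hvc : ContinuousOn v G.total)
    (hv : G.IsSubsolution H G.inner v) {j : J} {s p : ℝ} (hs : s ∈ Ioo 0 (G.len j))
    (hp : HasDerivAt (fun s => v (G.arc j s)) p s) : H j s p ≤ 0 :=
  hv.edge_test hs (G.arc_mem_inner hs) (G.continuousOn_total_iff.1 hvc j) hp (by simp)

/-- The existence of a continuous subsolution makes every sublevel set `{H^j(s, ·) ≤ 0}`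
nonempty. -/
theorem IsSubsolution.exists_le_zero (hH : G.IsEikonal H) (hvc : ContinuousOn v G.total)
    (hv : G.IsSubsolution H G.inner v) (j : J) {s : ℝ} (hs : s ∈ Icc 0 (G.len j)) :
    ∃ p, H j s p ≤ 0 := by
  by_contra! hcon
  have hev := eventually_forall_lt (hH.continuous j) (hH.convex j) hs (hH.coercive j s hs) hcon
  obtain ⟨C, hC⟩ := hv.exists_lipschitzOnWith hH hvc j
  obtain ⟨V, hV, hVeq⟩ := hC.extend_real
  have hdense : Dense {x | DifferentiableAt ℝ V x} :=
    Measure.dense_of_ae hV.ae_differentiableAt_real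
  rw [eventually_nhdsWithin_iff, eventually_nhds_iff] at hev
  obtain ⟨U, hU, hUo, hsU⟩ := hev
  have hcl : s ∈ closure (Ioo 0 (G.len j)) := by rwa [closure_Ioo (G.len_pos j).ne]
  have hne := mem_closure_iff_nhds.1 hcl U (hUo.mem_nhds hsU)
  obtain ⟨r, ⟨hrU, hr⟩, hrd⟩ := hdense.inter_open_nonempty _ (hUo.inter isOpen_Ioo) hne
  have hd : HasDerivAt (fun s => v (G.arc j s)) (deriv V r) r :=
    (DifferentiableAt.hasDerivAt hrd).congr_of_eventuallyEq (by
      filter_upwards [isOpen_Ioo.mem_nhds hr] with t ht using hVeq (Ioo_subset_Icc_self ht))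
  exact absurd (hv.le_zero_of_hasDerivAt hvc hr hd) (not_le.2 (hU r hrU (Ioo_subset_Icc_self hr) _))

/-- Along a differentiable curve, the derivative of a subsolution is at most the Lagrangian. -/
theorem IsSubsolution.deriv_comp_le_lagrangian (hH : G.IsEikonal H) (hvc : ContinuousOn v G.total)
    (hv : G.IsSubsolution H G.inner v) {j : J} {σ : ℝ → ℝ} {t d : ℝ}
    (hσ : ContDiffAt ℝ 1 σ t) (hmem : ∀ᶠ r in 𝓝 t, σ r ∈ Icc 0 (G.len j))
    (hd : HasDerivAt (fun r => v (G.arc j (σ r))) d t) :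
    (d : EReal) ≤ lagrangian (H j (σ t)) (deriv σ t) := by
  have hst : HasStrictDerivAt σ (deriv σ t) t := hσ.hasStrictDerivAt one_ne_zero
  have ht := hmem.self_of_nhds
  by_cases hq : deriv σ t = 0
  · obtain ⟨C, hC⟩ := hv.exists_lipschitzOnWith hH hvc j
    have hd0 : HasDerivAt (fun r => v (G.arc j (σ r))) 0 t := by
      have h1 := hst.hasDerivAt
      rw [hq, hasDerivAt_iff_isLittleO] at h1
      rw [hasDerivAt_iff_isLittleO]
      simp only [smul_zero, sub_zero] at h1 ⊢
      refine Asymptotics.IsBigO.trans_isLittleO ?_ h1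
      refine Asymptotics.IsBigO.of_bound C ?_
      filter_upwards [hmem] with r hr
      simpa [dist_eq_norm] using hC.dist_le_mul _ hr _ ht
    obtain ⟨p, hp⟩ := hv.exists_le_zero hH hvc j ht
    rw [hd.unique hd0, hq]
    refine le_trans ?_ (le_lagrangian _ 0 p)
    rw [EReal.coe_le_coe_iff]
    linarith
  · have hio : σ t ∈ Ioo 0 (G.len j) := by
      refine ⟨lt_of_le_of_ne ht.1 fun e => hq ?_, lt_of_le_of_ne ht.2 fun e => hq ?_⟩
      · refine IsLocalMin.deriv_eq_zero ?_
        filter_upwards [hmem] with r hr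
        rw [← e]; exact hr.1
      · refine IsLocalMax.deriv_eq_zero ?_
        filter_upwards [hmem] with r hr
        rw [e]; exact hr.2
    have hst' := hst.hasStrictFDerivAt_equiv hq
    have hinv := hst.to_localInverse hq
    have hcomp : HasDerivAt (fun s => v (G.arc j s)) (d * (deriv σ t)⁻¹) (σ t) := by
      have e : HasDerivAt (fun r => v (G.arc j (σ r))) d
          (hst.localInverse σ _ t hq (σ t)) := by
        have : hst.localInverse σ _ t hq (σ t) = t := hst'.localInverse_apply_image
        rwa [this]
      refine (HasDerivAt.comp (σ t) e hinv.hasDerivAt).congr_of_eventuallyEq ?_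
      filter_upwards [hst'.eventually_right_inverse] with y hy
      exact congrArg (fun z => v (G.arc j z)) hy.symm
    have hle := hv.le_zero_of_hasDerivAt hvc hio hcomp
    refine le_trans ?_ (le_lagrangian _ _ (d * (deriv σ t)⁻¹))
    rw [EReal.coe_le_coe_iff, inv_mul_cancel_right₀ hq]
    linarith

/-- A subsolution increases along one piece of a path by at most the action of that piece. -/
theorem IsSubsolution.sub_le_erealIntegral (hH : G.IsEikonal H) (hvc : ContinuousOn v G.total)
    (hv : G.IsSubsolution H G.inner v) {j : J} {σ : ℝ → ℝ} {a b : ℝ} (hab : a < b)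
    (hσc : ContinuousOn σ (Icc a b)) (hσ : ContDiffOn ℝ 1 σ (Ioo a b))
    (hmem : ∀ t ∈ Icc a b, σ t ∈ Icc 0 (G.len j)) :
    ((v (G.arc j (σ b)) - v (G.arc j (σ a)) : ℝ) : EReal) ≤
      erealIntegral (Ioo a b) fun t => lagrangian (H j (σ t)) (deriv σ t) := by
  obtain ⟨C, hC⟩ := hv.exists_lipschitzOnWith hH hvc j
  obtain ⟨B, hB⟩ := (isCompact_Icc.image_of_continuousOn
    (continuousOn_left (hH.continuous j) 0)).bddAbove
  set F : ℝ → ℝ := fun r => v (G.arc j (σ r)) with hF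
  have hFc : ContinuousOn F (Icc a b) :=
    (G.continuousOn_total_iff.1 hvc j).comp hσc hmem
  -- the derivative of `σ` may be unbounded at `a` and `b`: integrate over `[a', b']` first
  have key : ∀ a' b', a < a' → a' ≤ b' → b' < b →
      ((F b' - F a' - B * ((a' - a) + (b - b')) : ℝ) : EReal) ≤
        erealIntegral (Ioo a b) fun t => lagrangian (H j (σ t)) (deriv σ t) := by
    intro a' b' ha hab' hb
    have hsub : Icc a' b' ⊆ Ioo a b := fun t ht => ⟨ha.trans_le ht.1, ht.2.trans_lt hb⟩
    have hdc : ContinuousOn (deriv σ) (Icc a' b') :=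
      (hσ.continuousOn_deriv_of_isOpen isOpen_Ioo le_rfl).mono hsub
    obtain ⟨D, hD⟩ := (isCompact_Icc.image_of_continuousOn hdc.nnnorm).bddAbove
    have hσL : LipschitzOnWith D σ (Icc a' b') :=
      (convex_Icc a' b').lipschitzOnWith_of_nnnorm_deriv_le
        (fun t ht => ((hσ.differentiableOn one_ne_zero).differentiableAt
          (isOpen_Ioo.mem_nhds (hsub ht)))) (fun t ht => hD ⟨t, ht, rfl⟩)
    have hFL : LipschitzOnWith (C * D) F (Icc a' b') :=
      hC.comp hσL fun t ht => hmem t (Ioo_subset_Icc_self (hsub ht))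
    have hac : AbsolutelyContinuousOnInterval F a' b' := by
      refine LipschitzOnWith.absolutelyContinuousOnInterval (K := C * D) ?_
      rwa [uIcc_of_le hab']
    have hdiff : ∀ᵐ t, t ∈ Icc a' b' → DifferentiableWithinAt ℝ F (Icc a' b') t :=
      hFL.ae_differentiableWithinAt_of_mem_real
    have hdi : IntegrableOn (deriv F) (Ioo a' b') :=
      ((intervalIntegrable_iff_integrableOn_Ioo_of_le hab').1 hac.intervalIntegrable_deriv)
    set φ : ℝ → ℝ := fun t => (Ioo a' b').indicator (fun t => deriv F t + B) t + -B with hφ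
    have hsub' : Ioo a' b' ⊆ Ioo a b := Ioo_subset_Icc_self.trans hsub
    have hi1 : IntegrableOn (fun t => deriv F t + B) (Ioo a' b') := hdi.add (by simp)
    have hi1' : IntegrableOn ((Ioo a' b').indicator (fun t => deriv F t + B)) (Ioo a b) :=
      (integrable_indicator_iff measurableSet_Ioo |>.2 hi1).integrableOn
    have hφi : IntegrableOn φ (Ioo a b) := hi1'.add (by simp)
    have hint : ∫ t in Ioo a b, φ t = F b' - F a' - B * ((a' - a) + (b - b')) := by
      have e1 : ∫ t in Ioo a' b', deriv F t = F b' - F a' := by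
        rw [← hac.integral_deriv_eq_sub, intervalIntegral.integral_of_le hab',
          integral_Ioc_eq_integral_Ioo]
      rw [hφ, integral_add hi1' (by simp), setIntegral_indicator measurableSet_Ioo,
        inter_eq_right.2 hsub', integral_add hdi (by simp), e1]
      simp only [integral_const, MeasurableSet.univ, measureReal_restrict_apply, univ_inter,
        Real.volume_real_Ioo_of_le hab', Real.volume_real_Ioo_of_le hab.le, smul_eq_mul]
      ring
    rw [← hint, ← erealIntegral_coe hφi]
    refine erealIntegral_mono ((ae_restrict_iff' measurableSet_Ioo).2 ?_)
    filter_upwards [hdiff] with t htd htab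
    by_cases ht : t ∈ Ioo a' b'
    · have hda : DifferentiableAt ℝ F t :=
        (htd (Ioo_subset_Icc_self ht)).differentiableAt (Icc_mem_nhds ht.1 ht.2)
      have e : φ t = deriv F t := by simp [hφ, ht]
      rw [e]
      refine hv.deriv_comp_le_lagrangian hH hvc
        ((hσ t htab).contDiffAt (isOpen_Ioo.mem_nhds htab)) ?_ hda.hasDerivAt
      filter_upwards [isOpen_Ioo.mem_nhds htab] with r hr using hmem r (Ioo_subset_Icc_self hr)
    · have e : φ t = -B := by simp [hφ, ht]
      rw [e]
      refine le_trans ?_ (le_lagrangian _ _ 0)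
      rw [EReal.coe_le_coe_iff]
      have := hB ⟨σ t, hmem t (Ioo_subset_Icc_self htab), rfl⟩
      simp only at this
      linarith
  have htend : Tendsto (fun δ : ℝ => ((F (b - δ) - F (a + δ) -
      B * ((a + δ - a) + (b - (b - δ))) : ℝ) : EReal)) (𝓝[>] 0)
      (𝓝 ((F b - F a - B * ((a + 0 - a) + (b - (b - 0))) : ℝ) : EReal)) := by
    refine (continuous_coe_real_ereal.tendsto _).comp ?_
    have hsm : ∀ᶠ δ : ℝ in 𝓝[>] 0, δ ∈ Ioo 0 (b - a) := Ioo_mem_nhdsGT (by linarith)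
    have hFb : Tendsto (fun δ : ℝ => F (b - δ)) (𝓝[>] 0) (𝓝 (F b)) := by
      refine (hFc b (right_mem_Icc.2 hab.le)).tendsto.comp (tendsto_nhdsWithin_iff.2 ⟨?_, ?_⟩)
      · have : Continuous fun δ : ℝ => b - δ := by fun_prop
        simpa using (this.tendsto 0).mono_left nhdsWithin_le_nhds
      · filter_upwards [hsm] with δ hδ using ⟨by linarith [hδ.2], by linarith [hδ.1]⟩
    have hFa : Tendsto (fun δ : ℝ => F (a + δ)) (𝓝[>] 0) (𝓝 (F a)) := by
      refine (hFc a (left_mem_Icc.2 hab.le)).tendsto.comp (tendsto_nhdsWithin_iff.2 ⟨?_, ?_⟩)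
      · have : Continuous fun δ : ℝ => a + δ := by fun_prop
        simpa using (this.tendsto 0).mono_left nhdsWithin_le_nhds
      · filter_upwards [hsm] with δ hδ using ⟨by linarith [hδ.1], by linarith [hδ.2]⟩
    refine (hFb.sub hFa).sub ?_
    have : Continuous fun δ : ℝ => B * ((a + δ - a) + (b - (b - δ))) := by fun_prop
    exact (this.tendsto 0).mono_left nhdsWithin_le_nhds
  have hfin := le_of_tendsto htend (b := erealIntegral (Ioo a b) fun t =>
    lagrangian (H j (σ t)) (deriv σ t)) (by
      filter_upwards [Ioo_mem_nhdsGT (by linarith : (0 : ℝ) < (b - a) / 2)] with δ hδ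
      exact key (a + δ) (b - δ) (by linarith [hδ.1]) (by linarith [hδ.2]) (by linarith [hδ.1]))
  simpa using hfin

end

theorem coord_continuousOn (G : TopNetwork N I J) (j : J) :
    ContinuousOn (G.coord j) (G.closedEdge j) := by
  intro x hx
  rw [ContinuousWithinAt, ← G.arc_coord hx, ← G.map_arc_nhdsWithin j (G.coord_mem hx),
    tendsto_map'_iff, G.arc_coord hx]
  have : Tendsto (fun s : ℝ => s) (𝓝[Icc 0 (G.len j)] (G.coord j x)) (𝓝 (G.coord j x)) :=
    nhdsWithin_le_nhds
  refine this.congr' ?_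
  filter_upwards [self_mem_nhdsWithin] with s hs using (G.coord_arc j hs).symm

theorem sum_succ_sub_castSucc {n : ℕ} (f : Fin (n + 1) → ℝ) :
    ∑ m : Fin n, (f m.succ - f m.castSucc) = f (Fin.last n) - f 0 := by
  have e1 := Fin.sum_univ_succ f
  have e2 := Fin.sum_univ_castSucc f
  rw [Finset.sum_sub_distrib]
  linarith

/-- Continuous subsolutions are dominated by the intrinsic distance. -/
theorem IsSubsolution.sub_le_dist [Finite I] [Finite J] {H : J → ℝ → ℝ → ℝ}
    (hH : G.IsEikonal H) {v : EuclideanSpace ℝ (Fin N) → ℝ} (hvc : ContinuousOn v G.total)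
    (hv : G.IsSubsolution H G.inner v) (y x : EuclideanSpace ℝ (Fin N)) :
    ((v x - v y : ℝ) : EReal) ≤ G.dist H y x := by
  refine le_iInf fun c => ?_
  have h1 : v x - v y = ∑ m : Fin (c.n + 1), (v (c.γ (c.τ m.succ)) - v (c.γ (c.τ m.castSucc))) := by
    rw [sum_succ_sub_castSucc fun i => v (c.γ (c.τ i)), c.end_eq, c.τ_zero, c.start_eq]
  have h2 : ((v x - v y : ℝ) : EReal) =
      ∑ m : Fin (c.n + 1), ((v (c.γ (c.τ m.succ)) - v (c.γ (c.τ m.castSucc)) : ℝ) : EReal) := by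
    rw [h1]
    exact map_sum (⟨⟨Real.toEReal, rfl⟩, EReal.coe_add⟩ : ℝ →+ EReal) _ _
  rw [h2]
  refine Finset.sum_le_sum fun m _ => ?_
  have hlt : c.τ m.castSucc < c.τ m.succ := c.τ_strictMono Fin.castSucc_lt_succ
  have hsub : Icc (c.τ m.castSucc) (c.τ m.succ) ⊆ Icc 0 (c.τ (Fin.last (c.n + 1))) :=
    Icc_subset_Icc (c.τ_nonneg _) (c.τ_le_last _)
  have := hv.sub_le_erealIntegral hH hvc (j := c.edge m)
    (σ := fun s => G.coord (c.edge m) (c.γ s)) hlt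
    ((G.coord_continuousOn _).comp (c.continuousOn.mono hsub) (c.mem_edge m)) (c.contDiffOn m)
    (fun t ht => G.coord_mem (c.mem_edge m t ht))
  rwa [G.arc_coord (c.mem_edge m _ (right_mem_Icc.2 hlt.le)),
    G.arc_coord (c.mem_edge m _ (left_mem_Icc.2 hlt.le))] at this

end TopNetwork

/-! ### The intrinsic distance and the functions it dominates -/

theorem le_of_hasDerivWithinAt_of_right {f : ℝ → ℝ} {l s₀ p p₁ : ℝ}
    (hf : HasDerivWithinAt f p (Icc 0 l) s₀) (h0 : 0 ≤ s₀) (hl : s₀ < l)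
    (h : ∀ᶠ s in 𝓝[Icc 0 l] s₀, s₀ < s → p₁ * (s - s₀) ≤ f s - f s₀) : p₁ ≤ p := by
  have hsub : Ioo s₀ l ⊆ Icc 0 l := fun s hs => ⟨h0.trans hs.1.le, hs.2.le⟩
  have h1 : HasDerivWithinAt f p (Ioo s₀ l) s₀ := hf.mono hsub
  rw [hasDerivWithinAt_iff_tendsto_slope' (by simp)] at h1
  have hne : (𝓝[Ioo s₀ l] s₀).NeBot := by
    rw [nhdsWithin_Ioo_eq_nhdsGT hl]; infer_instance
  refine ge_of_tendsto h1 ?_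
  filter_upwards [h.filter_mono (nhdsWithin_mono _ hsub), self_mem_nhdsWithin] with s hs hs'
  rw [slope_def_field, le_div_iff₀ (by linarith [hs'.1])]
  exact hs hs'.1

theorem le_of_hasDerivWithinAt_of_left {f : ℝ → ℝ} {l s₀ p p₁ : ℝ}
    (hf : HasDerivWithinAt f p (Icc 0 l) s₀) (h0 : 0 < s₀) (hl : s₀ ≤ l)
    (h : ∀ᶠ s in 𝓝[Icc 0 l] s₀, s < s₀ → p₁ * (s - s₀) ≤ f s - f s₀) : p ≤ p₁ := by
  have hsub : Ioo 0 s₀ ⊆ Icc 0 l := fun s hs => ⟨hs.1.le, hs.2.le.trans hl⟩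
  have h1 : HasDerivWithinAt f p (Ioo 0 s₀) s₀ := hf.mono hsub
  rw [hasDerivWithinAt_iff_tendsto_slope' (by simp)] at h1
  have hne : (𝓝[Ioo 0 s₀] s₀).NeBot := by
    rw [nhdsWithin_Ioo_eq_nhdsLT h0]; infer_instance
  refine le_of_tendsto h1 ?_
  filter_upwards [h.filter_mono (nhdsWithin_mono _ hsub), self_mem_nhdsWithin] with s hs hs'
  rw [slope_def_field, div_le_iff_of_neg (by linarith [hs'.2])]
  exact hs hs'.2

/-- A property holding near `s₀` in an interval holds on all segments from `s₀` to nearby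
points. -/
theorem eventually_uIcc {a b s₀ : ℝ} {P : ℝ → Prop} (hs₀ : s₀ ∈ Icc a b)
    (h : ∀ᶠ s in 𝓝[Icc a b] s₀, P s) :
    ∀ᶠ s in 𝓝[Icc a b] s₀, ∀ r ∈ uIcc s s₀, P r := by
  obtain ⟨ε, hε, hball⟩ := Metric.mem_nhdsWithin_iff.1 h
  filter_upwards [inter_mem_nhdsWithin _ (Metric.ball_mem_nhds s₀ hε)] with s hs r hr
  refine hball ⟨?_, uIcc_subset_Icc hs.1 hs₀ hr⟩
  have h1 : |r - s₀| ≤ |s - s₀| := by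
    rw [abs_sub_comm s s₀, abs_sub_comm r s₀]; exact abs_sub_right_of_mem_uIcc hr
  rw [Metric.mem_ball, Real.dist_eq]
  exact h1.trans_lt (by simpa [Real.dist_eq] using hs.2)

namespace TopNetwork

variable {N : ℕ} {I J : Type*} {G : TopNetwork N I J} {H : J → ℝ → ℝ → ℝ}

theorem IsEikonal.exists_dist_le_mul_abs (hH : G.IsEikonal H) (j : J) :
    ∃ C : ℝ, ∀ s₁ ∈ Icc 0 (G.len j), ∀ s₂ ∈ Icc 0 (G.len j),
      G.dist H (G.arc j s₁) (G.arc j s₂) ≤ ((C * |s₁ - s₂| : ℝ) : EReal) := by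
  obtain ⟨q, hq, M, hM, h⟩ := hH.exists_growth j
  refine ⟨M / q, fun s₁ h₁ s₂ h₂ => ?_⟩
  have hMq : M / q * q = M := div_mul_cancel₀ _ hq.ne'
  rcases lt_trichotomy s₁ s₂ with hlt | rfl | hlt
  · rw [abs_of_neg (by linarith), neg_sub]
    refine G.dist_arc_le_mul H (q := q) h₁ h₂ (mul_pos hq (by linarith)) fun s hs p => ?_
    have := h s (uIcc_subset_Icc h₁ h₂ hs) p
    nlinarith [le_abs_self p]
  · -- waiting for a short time is cheap
    rw [sub_self, abs_zero, mul_zero]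
    refine EReal.le_of_forall_lt_iff_le.1 fun r hr => ?_
    have hr' : 0 < r := EReal.coe_lt_coe_iff.1 hr
    have := G.dist_le_of_speed H (j := j) (s := s₁) (q := 0) (T := r / M) (M := M)
      (div_pos hr' hM) (fun t _ => by simpa using h₁) (fun t _ p => ?_)
    · simpa [div_mul_cancel₀ _ hM.ne'] using this
    · have := h s₁ h₁ p
      simp only [zero_mul, add_zero, mul_zero]
      nlinarith [abs_nonneg p, mul_nonneg hq.le (abs_nonneg p)]
  · rw [abs_of_pos (by linarith), show M / q * (s₁ - s₂) = -(M / q) * (s₂ - s₁) by ring]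
    refine G.dist_arc_le_mul H (q := -q) h₁ h₂ (by nlinarith) fun s hs p => ?_
    have := h s (uIcc_subset_Icc h₁ h₂ hs) p
    nlinarith [neg_abs_le p]

/-- Any two points are joined by a path of finite action, along a chain of edges. -/
theorem IsEikonal.exists_dist_le (hH : G.IsEikonal H) {y x} (hy : y ∈ G.total)
    (hx : x ∈ G.total) : ∃ a : ℝ, G.dist H y x ≤ a := by
  have hedge : ∀ j, ∀ y ∈ G.closedEdge j, ∀ x ∈ G.closedEdge j, ∃ a : ℝ, G.dist H y x ≤ a := by
    rintro j _ ⟨s₁, h₁, rfl⟩ _ ⟨s₂, h₂, rfl⟩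
    obtain ⟨C, hC⟩ := hH.exists_dist_le_mul_abs j
    exact ⟨_, hC s₁ h₁ s₂ h₂⟩
  have htrans : ∀ y x z, (∃ a : ℝ, G.dist H y x ≤ a) → (∃ a : ℝ, G.dist H x z ≤ a) →
      ∃ a : ℝ, G.dist H y z ≤ a := by
    rintro y x z ⟨a, ha⟩ ⟨b, hb⟩
    exact ⟨_, G.dist_triangle_of_le ha hb⟩
  obtain ⟨j, hj⟩ := mem_iUnion.1 hy
  obtain ⟨k, hk⟩ := mem_iUnion.1 hx
  obtain ⟨a, ha⟩ := G.arc_start j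
  obtain ⟨b, hb⟩ := G.arc_start k
  obtain ⟨n, e, h0, hlast, hchain⟩ := G.connected a b
  have hind : ∀ m : Fin (n + 1), ∀ z ∈ G.closedEdge (e m), ∃ a : ℝ, G.dist H y z ≤ a := by
    intro m
    induction m using Fin.induction with
    | zero =>
      intro z hz
      exact htrans _ _ _ (hedge j _ hj _ (ha ▸ G.arc_mem j (G.zero_mem j))) (hedge _ _ h0 _ hz)
    | succ m ih =>
      intro z hz
      obtain ⟨w, hw⟩ := ncard_eq_one.1 (hchain m)
      have hw' : w ∈ G.closedEdge (e m.castSucc) ∩ G.closedEdge (e m.succ) :=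
        hw.symm ▸ mem_singleton w
      exact htrans _ _ _ (ih w hw'.1) (hedge _ _ hw'.2 _ hz)
  exact htrans _ _ _ (hind _ _ hlast) (hedge k _ (hb ▸ G.arc_mem k (G.zero_mem k)) _ hk)

theorem IsEikonal.exists_real_dist [Finite I] [Finite J] (hH : G.IsEikonal H)
    (hsub : ∃ w : EuclideanSpace ℝ (Fin N) → ℝ,
      ContinuousOn w G.total ∧ G.IsSubsolution H G.inner w) :
    ∃ S : EuclideanSpace ℝ (Fin N) → EuclideanSpace ℝ (Fin N) → ℝ,
      ∀ y ∈ G.total, ∀ x ∈ G.total, G.dist H y x = (S y x : EReal) := by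
  obtain ⟨w, hwc, hw⟩ := hsub
  refine ⟨fun y x => (G.dist H y x).toReal, fun y hy x hx => (EReal.coe_toReal ?_ ?_).symm⟩
  · obtain ⟨a, ha⟩ := hH.exists_dist_le hy hx
    exact (ha.trans_lt (EReal.coe_lt_top a)).ne
  · exact ((EReal.bot_lt_coe _).trans_le (hw.sub_le_dist hH hwc y x)).ne'

/-- At a vertex the Hamiltonian is even, so its sublevel set contains `0`. -/
theorem IsEikonal.vert_zero_le (hH : G.IsEikonal H)
    (hZ : ∀ j, ∀ s ∈ Icc 0 (G.len j), ∃ p, H j s p ≤ 0) {i : I} {j : J} (h : G.Inc i j) :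
    H j (G.coord j (G.vert i)) 0 ≤ 0 := by
  obtain ⟨p, hp⟩ := hZ j _ (G.coord_mem h)
  have hp' : H j (G.coord j (G.vert i)) (-p) ≤ 0 := by rwa [← hH.even i j h p]
  have := (hH.convex j _ (G.coord_mem h)).2 (mem_univ p) (mem_univ (-p))
    (by norm_num : (0 : ℝ) ≤ 1 / 2) (by norm_num : (0 : ℝ) ≤ 1 / 2) (by norm_num)
  simp only [smul_eq_mul] at this
  rw [show 1 / 2 * p + 1 / 2 * -p = 0 by ring] at this
  linarith

/-- The subsolution inequality for a function dominated by the distance, at any point of a closed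
edge: if the slope `p` of the test function lies outside the sublevel set, on the side from which
the point can be approached along the edge, then a path arriving with a suitable constant speed is
cheaper than the test function allows. -/
theorem le_zero_of_sub_le_dist (hH : G.IsEikonal H) {u : EuclideanSpace ℝ (Fin N) → ℝ}
    (hu : ∀ y ∈ G.total, ∀ x ∈ G.total, ((u x - u y : ℝ) : EReal) ≤ G.dist H y x)
    {j : J} {s₀ p p₀ : ℝ} (hs₀ : s₀ ∈ Icc 0 (G.len j)) {f : ℝ → ℝ}
    (hf : HasDerivWithinAt f p (Icc 0 (G.len j)) s₀)
    (hmax : ∀ᶠ s in 𝓝[Icc 0 (G.len j)] s₀, u (G.arc j s) - f s ≤ u (G.arc j s₀) - f s₀)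
    (hp₀ : H j s₀ p₀ ≤ 0) (hside : p₀ < p ∧ 0 < s₀ ∨ p < p₀ ∧ s₀ < G.len j) :
    H j s₀ p ≤ 0 := by
  by_contra! hpos
  have hnear := (continuous_right (hH.continuous j) hs₀).continuousAt.eventually (lt_mem_nhds hpos)
  have huj : ∀ s ∈ Icc 0 (G.len j), ∀ c : ℝ,
      G.dist H (G.arc j s) (G.arc j s₀) ≤ c → u (G.arc j s₀) - u (G.arc j s) ≤ c :=
    fun s hs c hc => EReal.coe_le_coe_iff.1
      ((hu _ (G.arc_mem_total j hs) _ (G.arc_mem_total j hs₀)).trans hc)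
  rcases hside with ⟨hlt, h0⟩ | ⟨hlt, hl⟩
  · obtain ⟨p₁, h1, h2, h3⟩ : ∃ p₁, 0 < H j s₀ p₁ ∧ p₁ ∈ Ioo p₀ p :=
      ((hnear.filter_mono nhdsWithin_le_nhds).and (Ioo_mem_nhdsLT hlt)).exists
    obtain ⟨q, hq, hev⟩ := eventually_lagrangian_le_of_gt (hH.continuous j) (hH.convex j) hs₀
      (hH.coercive j s₀ hs₀) hp₀ h1 h2
    refine not_le.2 h3 (le_of_hasDerivWithinAt_of_left hf h0 hs₀.2 ?_)
    filter_upwards [eventually_uIcc hs₀ hev, hmax, self_mem_nhdsWithin] with s hs hm hsI hss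
    have := huj s hsI _ (G.dist_arc_le_mul H hsI hs₀ (mul_pos hq (by linarith)) hs)
    linarith
  · obtain ⟨p₁, h1, h2, h3⟩ : ∃ p₁, 0 < H j s₀ p₁ ∧ p₁ ∈ Ioo p p₀ :=
      ((hnear.filter_mono nhdsWithin_le_nhds).and (Ioo_mem_nhdsGT hlt)).exists
    obtain ⟨q, hq, hev⟩ := eventually_lagrangian_le_of_lt (hH.continuous j) (hH.convex j) hs₀
      (hH.coercive j s₀ hs₀) hp₀ h1 h3
    refine not_le.2 h2 (le_of_hasDerivWithinAt_of_right hf hs₀.1 hl ?_)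
    filter_upwards [eventually_uIcc hs₀ hev, hmax, self_mem_nhdsWithin] with s hs hm hsI hss
    have := huj s hsI _ (G.dist_arc_le_mul H hsI hs₀ (mul_pos_of_neg_of_neg hq (by linarith)) hs)
    linarith

theorem continuousOn_of_sub_le_dist [Finite J] (hH : G.IsEikonal H)
    {u : EuclideanSpace ℝ (Fin N) → ℝ}
    (hu : ∀ y ∈ G.total, ∀ x ∈ G.total, ((u x - u y : ℝ) : EReal) ≤ G.dist H y x) :
    ContinuousOn u G.total := by
  refine G.continuousOn_total_iff.2 fun j => ?_
  obtain ⟨C, hC⟩ := hH.exists_dist_le_mul_abs j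
  have hle : ∀ s ∈ Icc 0 (G.len j), ∀ r ∈ Icc 0 (G.len j),
      u (G.arc j s) - u (G.arc j r) ≤ C * |r - s| := fun s hs r hr => EReal.coe_le_coe_iff.1
    ((hu _ (G.arc_mem_total j hr) _ (G.arc_mem_total j hs)).trans (hC r hr s hs))
  have : LipschitzOnWith (Real.toNNReal C) (fun s => u (G.arc j s)) (Icc 0 (G.len j)) := by
    refine LipschitzOnWith.of_dist_le_mul fun s hs r hr => ?_
    have h1 : |u (G.arc j s) - u (G.arc j r)| ≤ C * |r - s| :=
      abs_le.2 ⟨by have := hle r hr s hs; rw [abs_sub_comm] at this; linarith, hle s hs r hr⟩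
    rw [Real.dist_eq, Real.dist_eq, abs_sub_comm s r]
    exact h1.trans (mul_le_mul_of_nonneg_right (Real.le_coe_toNNReal C) (abs_nonneg _))
  exact this.continuousOn

theorem eventually_along_edge [Finite I] [Finite J] {x} (hx : x ∈ G.inner) {j : J}
    (hj : x ∈ G.closedEdge j) {P : EuclideanSpace ℝ (Fin N) → Prop}
    (h : ∀ᶠ z in 𝓝[G.inner] x, P z) :
    ∀ᶠ s in 𝓝[Icc 0 (G.len j)] (G.coord j x), P (G.arc j s) :=
  (G.eventually_inner_iff hx).1 h j hj

theorem EdgeDiffAt.hasDerivWithinAt {j : J} {φ : EuclideanSpace ℝ (Fin N) → ℝ} {x}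
    (h : G.EdgeDiffAt j φ x) :
    HasDerivWithinAt (fun s => φ (G.arc j s)) (G.edgeDeriv j φ x) (Icc 0 (G.len j))
      (G.coord j x) := DifferentiableWithinAt.hasDerivWithinAt h

/-- The derivative along the second edge of a `(j,k)`-differentiable function. -/
theorem JKDiffAt.edgeDeriv_eq {i : I} {j k : J} {φ : EuclideanSpace ℝ (Fin N) → ℝ}
    (h : G.JKDiffAt i j k φ) (hk : G.Inc i k) :
    G.edgeDeriv k φ (G.vert i) = -(G.sgn i k * G.sgn i j) * G.edgeDeriv j φ (G.vert i) := by
  have h1 := h.2.2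
  have h2 := G.sgn_mul_self hk
  linear_combination G.sgn i k * h1 - G.edgeDeriv k φ (G.vert i) * h2

/-- At a vertex the value of the Hamiltonian on the slopes of a `(j,k)`-differentiable function is
the same along both edges. -/
theorem IsEikonal.vert_edgeDeriv_eq (hH : G.IsEikonal H) {i : I} {j k : J} (hj : G.Inc i j)
    (hk : G.Inc i k) {φ : EuclideanSpace ℝ (Fin N) → ℝ} (h : G.JKDiffAt i j k φ) :
    H k (G.coord k (G.vert i)) (G.edgeDeriv k φ (G.vert i)) =
      H j (G.coord j (G.vert i)) (G.edgeDeriv j φ (G.vert i)) := by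
  rw [hH.compat i k j hk hj, h.edgeDeriv_eq hk]
  have he := hH.even i j hj (G.edgeDeriv j φ (G.vert i))
  rcases G.sgn_coord_cases hj with ⟨a, -⟩ | ⟨a, -⟩ <;> rcases G.sgn_coord_cases hk with ⟨b, -⟩ | ⟨b, -⟩ <;>
    simp [a, b, ← he]

/-- A function dominated by the distance is a continuous subsolution. -/
theorem isSubsolution_of_sub_le_dist [Finite I] [Finite J] (hH : G.IsEikonal H)
    (hZ : ∀ j, ∀ s ∈ Icc 0 (G.len j), ∃ p, H j s p ≤ 0)
    {u : EuclideanSpace ℝ (Fin N) → ℝ}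
    (hu : ∀ y ∈ G.total, ∀ x ∈ G.total, ((u x - u y : ℝ) : EReal) ≤ G.dist H y x) :
    G.IsSubsolution H G.inner u := by
  refine ⟨(continuousOn_of_sub_le_dist hH hu).upperSemicontinuousOn, ?_, ?_⟩
  · rintro j x ⟨s₀, hs₀, rfl⟩ hx φ hφ hd hmax
    have hs := Ioo_subset_Icc_self hs₀
    have hder := hd.hasDerivWithinAt
    have hev := eventually_along_edge hx (G.arc_mem j hs) hmax
    rw [G.coord_arc j hs] at hder hev ⊢
    obtain ⟨p₀, hp₀⟩ := hZ j s₀ hs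
    rcases lt_trichotomy p₀ (G.edgeDeriv j φ (G.arc j s₀)) with hlt | heq | hlt
    · exact le_zero_of_sub_le_dist hH hu hs hder hev hp₀ (Or.inl ⟨hlt, hs₀.1⟩)
    · exact heq ▸ hp₀
    · exact le_zero_of_sub_le_dist hH hu hs hder hev hp₀ (Or.inr ⟨hlt, hs₀.2⟩)
  · intro i hi hx j k hj hk hjk φ hφ hd hmax
    -- along the edge where the outgoing slope of `φ` is negative, paths arrive at the vertex
    have key : ∀ j, G.Inc i j → G.EdgeDiffAt j φ (G.vert i) →
        G.sgn i j * G.edgeDeriv j φ (G.vert i) < 0 →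
        H j (G.coord j (G.vert i)) (G.edgeDeriv j φ (G.vert i)) ≤ 0 := by
      intro j hj hd hneg
      have hev := eventually_along_edge hx hj hmax
      have h0 := hH.vert_zero_le hZ hj
      have hl := G.len_pos j
      simp only at hev
      rw [← G.arc_coord hj, G.arc_coord hj] at hev
      refine le_zero_of_sub_le_dist hH hu (G.coord_mem hj) hd.hasDerivWithinAt
        (by simpa only [G.arc_coord hj] using hev) h0 ?_
      rcases G.sgn_coord_cases hj with ⟨a, b⟩ | ⟨a, b⟩
      · right; rw [a] at hneg; rw [b]; exact ⟨by linarith, hl⟩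
      · left; rw [a] at hneg; rw [b]; exact ⟨by linarith, hl⟩
    rcases lt_trichotomy (G.sgn i j * G.edgeDeriv j φ (G.vert i)) 0 with hlt | heq | hgt
    · exact key j hj hd.1 hlt
    · have : G.edgeDeriv j φ (G.vert i) = 0 := by
        have h2 := G.sgn_mul_self hj
        linear_combination G.sgn i j * heq - G.edgeDeriv j φ (G.vert i) * h2
      rw [this]
      exact hH.vert_zero_le hZ hj
    · rw [← hH.vert_edgeDeriv_eq hj hk hd]
      exact key k hk hd.2.1 (by linarith [hd.2.2])

end TopNetwork

/-! ### Local modification of subsolutions and the supersolution property -/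

/-- If `f` stays above the cone `r ↦ m r - b |r - s₀|` touching it at `s`, then its derivative at
`s` lies within `b` of `m`, on each side on which `s` can be approached. -/
theorem slope_bounds_of_cone {f : ℝ → ℝ} {l s s₀ p m b : ℝ} (hb : 0 ≤ b) (hs : s ∈ Icc 0 l)
    (hf : HasDerivWithinAt f p (Icc 0 l) s)
    (h : ∀ᶠ r in 𝓝[Icc 0 l] s, m * r - b * |r - s₀| - f r ≤ m * s - b * |s - s₀| - f s) :
    (s < l → m - b ≤ p) ∧ (0 < s → p ≤ m + b) := by
  have key : ∀ᶠ r in 𝓝[Icc 0 l] s, m * (r - s) - b * |r - s| ≤ f r - f s := by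
    filter_upwards [h] with r hr
    have h1 : |r - s₀| ≤ |r - s| + |s - s₀| := abs_sub_le r s s₀
    nlinarith [mul_le_mul_of_nonneg_left h1 hb]
  refine ⟨fun hsl => le_of_hasDerivWithinAt_of_right hf hs.1 hsl ?_,
    fun h0 => le_of_hasDerivWithinAt_of_left hf h0 hs.2 ?_⟩
  · filter_upwards [key] with r hr hrs
    rw [abs_of_pos (by linarith)] at hr
    linarith
  · filter_upwards [key] with r hr hrs
    rw [abs_of_neg (by linarith)] at hr
    linarith

namespace TopNetwork

variable {N : ℕ} {I J : Type*} {G : TopNetwork N I J} {H : J → ℝ → ℝ → ℝ}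

/-- Let `u` lie, along all edges near `x`, above a cone with vertex at the graph of `u` over `x`
that is a strict subsolution up to its vertex. Then lifting the cone slightly and taking the maximum
with `u` gives a subsolution that is larger than `u` at `x`, equal to `u` away from `x`, and strict
near `x`. -/
theorem IsSubsolution.exists_bump [Finite I] [Finite J] (hH : G.IsEikonal H)
    {u : EuclideanSpace ℝ (Fin N) → ℝ} (huc : ContinuousOn u G.total)
    (hu : G.IsSubsolution H G.inner u) {x} (hx : x ∈ G.inner) {m b₀ b : J → ℝ}
    (hm : x ∈ range G.vert → ∀ k, m k = 0)
    (hb₀ : ∀ k, x ∈ G.closedEdge k → 0 ≤ b₀ k) (hb : ∀ k, x ∈ G.closedEdge k → b₀ k < b k)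
    (hneg : ∀ k, x ∈ G.closedEdge k →
      H k (G.coord k x) (m k - b k) < 0 ∧ H k (G.coord k x) (m k + b k) < 0)
    (hlow : ∀ k, x ∈ G.closedEdge k → ∀ᶠ s in 𝓝[Icc 0 (G.len k)] (G.coord k x),
      u x + m k * (s - G.coord k x) - b₀ k * |s - G.coord k x| ≤ u (G.arc k s))
    {U : Set (EuclideanSpace ℝ (Fin N))} (hU : U ∈ 𝓝 x) :
    ∃ w : EuclideanSpace ℝ (Fin N) → ℝ, ContinuousOn w G.total ∧ G.IsSubsolution H G.inner w ∧
      (∀ z ∈ G.total, z ∉ U → w z = u z) ∧ u x < w x ∧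
      ∃ δ > 0, ∃ U', IsOpen U' ∧ x ∈ U' ∧
        G.IsSubsolution (fun j s p => H j s p + δ) (G.inner ∩ U') w := by
  classical
  have hxt : x ∈ G.total := hx.1
  obtain ⟨δ, hδ, hδ0⟩ : ∃ δ, (∀ k, x ∈ G.closedEdge k →
      H k (G.coord k x) (m k - b k) < -δ ∧ H k (G.coord k x) (m k + b k) < -δ) ∧ 0 < δ := by
    have h1 : ∀ᶠ δ : ℝ in 𝓝[>] 0, ∀ k, x ∈ G.closedEdge k →
        H k (G.coord k x) (m k - b k) < -δ ∧ H k (G.coord k x) (m k + b k) < -δ := by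
      refine eventually_all.2 fun k => eventually_imp_distrib_left.2 fun hk => ?_
      obtain ⟨h1, h2⟩ := hneg k hk
      filter_upwards [Ioo_mem_nhdsGT (neg_pos.2 h1), Ioo_mem_nhdsGT (neg_pos.2 h2)] with δ a c
      exact ⟨by linarith [a.2], by linarith [c.2]⟩
    exact (h1.and self_mem_nhdsWithin).exists
  -- on `|s - s_k| ≤ ρ` all local properties hold, and `x` is the only possible vertex
  obtain ⟨ρ, hρ, hρ0⟩ : ∃ ρ, (∀ k, x ∈ G.closedEdge k → ∀ s ∈ Icc 0 (G.len k),
      |s - G.coord k x| ≤ ρ →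
      (H k s (m k - b k) < -δ ∧ H k s (m k + b k) < -δ) ∧
      u x + m k * (s - G.coord k x) - b₀ k * |s - G.coord k x| ≤ u (G.arc k s) ∧
      G.arc k s ∈ U ∧ (G.arc k s ∈ range G.vert → s = G.coord k x)) ∧ 0 < ρ := by
    have h1 : ∀ᶠ ρ : ℝ in 𝓝[>] 0, ∀ k, x ∈ G.closedEdge k → ∀ s ∈ Icc 0 (G.len k),
        |s - G.coord k x| ≤ ρ →
        (H k s (m k - b k) < -δ ∧ H k s (m k + b k) < -δ) ∧
        u x + m k * (s - G.coord k x) - b₀ k * |s - G.coord k x| ≤ u (G.arc k s) ∧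
        G.arc k s ∈ U ∧ (G.arc k s ∈ range G.vert → s = G.coord k x) := by
      refine eventually_all.2 fun k => eventually_imp_distrib_left.2 fun hk => ?_
      have hs := G.coord_mem hk
      have e1 := (continuousOn_left (hH.continuous k) (m k - b k) _ hs).eventually
        (gt_mem_nhds (hδ k hk).1)
      have e2 := (continuousOn_left (hH.continuous k) (m k + b k) _ hs).eventually
        (gt_mem_nhds (hδ k hk).2)
      have e3 : ∀ᶠ s in 𝓝[Icc 0 (G.len k)] (G.coord k x), G.arc k s ∈ U :=
        (G.arc_continuousOn k _ hs) (by rwa [G.arc_coord hk])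
      have e4 : ∀ c : ℝ, ∀ᶠ s in 𝓝[Icc 0 (G.len k)] (G.coord k x), s = c → c = G.coord k x := by
        intro c
        by_cases hc : c = G.coord k x
        · simp [hc]
        · filter_upwards [nhdsWithin_le_nhds (isOpen_ne.mem_nhds (Ne.symm hc))] with s hs hsc
          exact absurd hsc hs
      have e5 := (((e1.and e2).and (hlow k hk)).and e3).and ((e4 0).and (e4 (G.len k)))
      obtain ⟨ε, hε, hball⟩ := Metric.mem_nhdsWithin_iff.1 e5
      filter_upwards [Ioo_mem_nhdsGT hε] with ρ hρ s hsI hsρ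
      obtain ⟨⟨⟨h1, h2⟩, h3⟩, h4, h5⟩ := hball ⟨by
        rw [Metric.mem_ball, Real.dist_eq]; exact hsρ.trans_lt hρ.2, hsI⟩
      refine ⟨h1, h2, h3, fun hv => ?_⟩
      rcases G.eq_zero_or_eq_len hsI hv with h | h
      · exact h.trans (h4 h)
      · exact h.trans (h5 h)
    exact (h1.and self_mem_nhdsWithin).exists
  obtain ⟨ε, hε, hε0⟩ : ∃ ε, (∀ k, x ∈ G.closedEdge k → ε < (b k - b₀ k) * ρ) ∧ 0 < ε := by
    have h1 : ∀ᶠ ε : ℝ in 𝓝[>] 0, ∀ k, x ∈ G.closedEdge k → ε < (b k - b₀ k) * ρ := by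
      refine eventually_all.2 fun k => eventually_imp_distrib_left.2 fun hk => ?_
      filter_upwards [Ioo_mem_nhdsGT (mul_pos (sub_pos.2 (hb k hk)) hρ0)] with ε h using h.2
    exact (h1.and self_mem_nhdsWithin).exists
  set cone : J → ℝ → ℝ := fun k s =>
    u x + ε + m k * (s - G.coord k x) - b k * |s - G.coord k x| with hcone
  have hconec : ∀ k, Continuous (cone k) := fun k => by fun_prop
  set f : J → ℝ → ℝ := fun k s => if x ∈ G.closedEdge k ∧ |s - G.coord k x| ≤ ρ then
    max (u (G.arc k s)) (cone k s) else u (G.arc k s) with hf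
  have hfu : ∀ k s, u (G.arc k s) ≤ f k s := by
    intro k s
    simp only [hf]
    split_ifs
    exacts [le_max_left _ _, le_rfl]
  have hcone_lt : ∀ k, x ∈ G.closedEdge k → ∀ s ∈ Icc 0 (G.len k), |s - G.coord k x| = ρ →
      cone k s < u (G.arc k s) := by
    intro k hk s hs hsρ
    have h1 := (hρ k hk s hs hsρ.le).2.1
    have h2 := hε k hk
    simp only [hcone]
    rw [hsρ] at h1 ⊢
    linarith
  have hf_vert : ∀ k, ∀ z ∈ G.closedEdge k, z ∈ range G.vert → z ≠ x →
      f k (G.coord k z) = u z := by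
    intro k z hz hv hzx
    have : ¬ (x ∈ G.closedEdge k ∧ |G.coord k z - G.coord k x| ≤ ρ) := by
      rintro ⟨hk, hle⟩
      have e := (hρ k hk _ (G.coord_mem hz) hle).2.2.2 (by rwa [G.arc_coord hz])
      exact hzx (by rw [← G.arc_coord hz, e, G.arc_coord hk])
    simp only [hf, if_neg this, G.arc_coord hz]
  have hf_x : ∀ k, x ∈ G.closedEdge k → f k (G.coord k x) = u x + ε := by
    intro k hk
    simp [hf, hcone, hk, hρ0.le, G.arc_coord hk, hε0.le]
  obtain ⟨w, hw⟩ := G.exists_glue f (by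
    intro j k z hj hk
    by_cases hjk : j = k
    · rw [hjk]
    by_cases hzx : z = x
    · subst hzx
      rw [hf_x j hj, hf_x k hk]
    · have hv := G.inter_subset j k hjk ⟨hj, hk⟩
      rw [hf_vert j z hj hv hzx, hf_vert k z hk hv hzx])
  have hwu : ∀ z ∈ G.total, u z ≤ w z := by
    intro z hz
    obtain ⟨k, s, hs, rfl⟩ := mem_iUnion.1 hz
    rw [hw k s hs]
    exact hfu k s
  have hwx : w x = u x + ε := by
    obtain ⟨k, hk⟩ := mem_iUnion.1 hxt
    have := hw k _ (G.coord_mem hk)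
    rwa [G.arc_coord hk, hf_x k hk] at this
  have hwc : ContinuousOn w G.total := by
    refine G.continuousOn_total_iff.2 fun k => ?_
    have hu1 := G.continuousOn_total_iff.1 huc k
    refine ContinuousOn.congr (f := f k) ?_ (hw k)
    by_cases hk : x ∈ G.closedEdge k
    swap
    · exact hu1.congr fun s _ => by simp [hf, hk]
    intro s hs
    have habs : Continuous fun r => |r - G.coord k x| := by fun_prop
    rcases lt_or_ge |s - G.coord k x| ρ with hlt | hge
    · have h1 : ContinuousOn (fun s => max (u (G.arc k s)) (cone k s)) (Icc 0 (G.len k)) :=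
        hu1.sup (hconec k).continuousOn
      refine (h1 s hs).congr_of_eventuallyEq ?_ (by simp [hf, hk, hlt.le])
      filter_upwards [nhdsWithin_le_nhds (habs.continuousAt.eventually (gt_mem_nhds hlt))] with r hr
      simp [hf, hk, hr.le]
    · -- outside, and on the rim of the zone, the cone is not seen
      have h2 : ∀ᶠ r in 𝓝[Icc 0 (G.len k)] s, |r - G.coord k x| ≤ ρ →
          cone k r < u (G.arc k r) := by
        rcases hge.eq_or_lt with heq | hgt
        · filter_upwards [((hconec k).continuousWithinAt).eventually_lt (hu1 s hs)
            (hcone_lt k hk s hs heq.symm)] with r hr _ using hr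
        · filter_upwards [nhdsWithin_le_nhds (habs.continuousAt.eventually (lt_mem_nhds hgt))]
            with r hr hr' using absurd hr' (not_le.2 hr)
      have h3 : ∀ r, (|r - G.coord k x| ≤ ρ → cone k r < u (G.arc k r)) →
          f k r = u (G.arc k r) := by
        intro r hr
        by_cases h : |r - G.coord k x| ≤ ρ
        · simp [hf, h, hk, (hr h).le]
        · simp [hf, h]
      refine (hu1 s hs).congr_of_eventuallyEq (h2.mono h3) (h3 s fun hle => ?_)
      exact hcone_lt k hk s hs (le_antisymm hle hge)
  -- where `w` exceeds `u`, it coincides with the lifted cone and lies above it nearby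
  have hzone : ∀ k, ∀ s ∈ Icc 0 (G.len k), u (G.arc k s) < w (G.arc k s) →
      x ∈ G.closedEdge k ∧ |s - G.coord k x| ≤ ρ ∧ w (G.arc k s) = cone k s ∧
      ∀ᶠ r in 𝓝[Icc 0 (G.len k)] s, cone k r ≤ w (G.arc k r) := by
    intro k s hs hlt
    rw [hw k s hs] at hlt
    have hz : x ∈ G.closedEdge k ∧ |s - G.coord k x| ≤ ρ := by
      by_contra hno
      simp only [hf, if_neg hno, lt_irrefl] at hlt
    have hfs : f k s = max (u (G.arc k s)) (cone k s) := by simp only [hf, if_pos hz]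
    have hul : u (G.arc k s) < cone k s := by
      rw [hfs] at hlt
      exact (lt_max_iff.1 hlt).resolve_left (lt_irrefl _)
    refine ⟨hz.1, hz.2, by rw [hw k s hs, hfs, max_eq_right hul.le], ?_⟩
    have hst : |s - G.coord k x| < ρ := lt_of_le_of_ne hz.2 fun e =>
      lt_asymm hul (hcone_lt k hz.1 s hs e)
    have habs : Continuous fun r => |r - G.coord k x| := by fun_prop
    filter_upwards [nhdsWithin_le_nhds (habs.continuousAt.eventually (gt_mem_nhds hst)),
      self_mem_nhdsWithin] with r hr hrI
    rw [hw k r hrI]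
    simp only [hf, if_pos (⟨hz.1, hr.le⟩ : x ∈ G.closedEdge k ∧ |r - G.coord k x| ≤ ρ)]
    exact le_max_right _ _
  have hbounds : ∀ k, ∀ z ∈ G.inner, z ∈ G.closedEdge k → u z < w z →
      ∀ φ : EuclideanSpace ℝ (Fin N) → ℝ, G.EdgeDiffAt k φ z →
      IsLocalMaxOn (fun z => w z - φ z) G.inner z →
      (G.coord k z < G.len k → m k - b k ≤ G.edgeDeriv k φ z) ∧
        (0 < G.coord k z → G.edgeDeriv k φ z ≤ m k + b k) := by
    intro k z hz hzk hlt φ hd hmax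
    have hev := eventually_along_edge hz hzk hmax
    have hc := G.coord_mem hzk
    obtain ⟨hk, -, heq, hnear⟩ := hzone k _ hc (by rwa [G.arc_coord hzk])
    refine slope_bounds_of_cone (s₀ := G.coord k x) ((hb₀ k hk).trans (hb k hk).le) hc
      hd.hasDerivWithinAt ?_
    rw [G.arc_coord hzk] at heq
    filter_upwards [hev, hnear] with r h1 h2
    rw [G.arc_coord hzk]
    simp only [hcone] at h2 heq
    linarith
  have hstrict_edge : ∀ j, ∀ z ∈ G.openEdge j, u z < w z →
      ∀ φ : EuclideanSpace ℝ (Fin N) → ℝ, G.EdgeDiffAt j φ z →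
      IsLocalMaxOn (fun z => w z - φ z) G.inner z →
      H j (G.coord j z) (G.edgeDeriv j φ z) ≤ -δ := by
    rintro j z ⟨s, hs, rfl⟩ hlt φ hd hmax
    have hsI := Ioo_subset_Icc_self hs
    obtain ⟨hk, hle, -, -⟩ := hzone j s hsI hlt
    have hbd := hbounds j _ (G.arc_mem_inner hs) (G.arc_mem j hsI) hlt φ hd hmax
    rw [G.coord_arc j hsI] at hbd ⊢
    obtain ⟨h1, h2⟩ := (hρ j hk s hsI hle).1
    exact ((hH.convex j s hsI).le_max_of_mem_Icc (mem_univ _) (mem_univ _)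
      ⟨hbd.1 hs.2, hbd.2 hs.1⟩).trans (max_le h1.le h2.le)
  have hstrict_vert : ∀ i, i ∉ G.bdryIdx → u (G.vert i) < w (G.vert i) →
      ∀ j k, G.Inc i j → G.Inc i k →
      ∀ φ : EuclideanSpace ℝ (Fin N) → ℝ, G.JKDiffAt i j k φ →
      IsLocalMaxOn (fun z => w z - φ z) G.inner (G.vert i) →
      H j (G.coord j (G.vert i)) (G.edgeDeriv j φ (G.vert i)) ≤ -δ := by
    intro i hi hlt j k hj hk φ hd hmax
    have hzx : G.vert i = x := by
      obtain ⟨hk, hle, -, -⟩ := hzone j _ (G.coord_mem hj) (by rwa [G.arc_coord hj])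
      have e := (hρ j hk _ (G.coord_mem hj) hle).2.2.2 (by
        rw [G.arc_coord hj]; exact mem_range_self i)
      rw [← G.arc_coord hj, e, G.arc_coord hk]
    have hm0 := hm (hzx ▸ mem_range_self i)
    have hinner := G.vert_mem_inner hi
    have hout : ∀ k, G.Inc i k → G.EdgeDiffAt k φ (G.vert i) →
        -b k ≤ G.sgn i k * G.edgeDeriv k φ (G.vert i) := by
      intro k hk hdk
      have hbd := hbounds k _ hinner hk hlt φ hdk hmax
      have hl := G.len_pos k
      rw [hm0 k] at hbd
      rcases G.sgn_coord_cases hk with ⟨a, c⟩ | ⟨a, c⟩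
      · rw [a, one_mul]
        have := hbd.1 (by rw [c]; exact hl)
        linarith
      · rw [a]
        have := hbd.2 (by rw [c]; exact hl)
        linarith
    have hj1 := hout j hj hd.1
    have hk1 := hout k hk hd.2.1
    have h1 := (hδ j (hzx ▸ hj)).1
    have h2 := (hδ k (hzx ▸ hk)).2
    rw [hm0, zero_sub, ← hzx] at h1
    rw [hm0, zero_add, ← hzx, hH.compat i k j hk hj] at h2
    have h3 := ((hH.convex j _ (G.coord_mem hj)).le_max_of_mem_Icc (mem_univ (-b j))
      (mem_univ (b k)) (z := G.sgn i j * G.edgeDeriv j φ (G.vert i))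
      ⟨hj1, by linarith [hd.2.2]⟩).trans (max_le h1.le h2.le)
    rcases G.sgn_coord_cases hj with ⟨a, -⟩ | ⟨a, -⟩
    · rwa [a, one_mul] at h3
    · rwa [a, neg_one_mul, ← hH.even i j hj] at h3
  have hpass : ∀ z ∈ G.inner, w z ≤ u z → ∀ φ : EuclideanSpace ℝ (Fin N) → ℝ,
      IsLocalMaxOn (fun z => w z - φ z) G.inner z →
      IsLocalMaxOn (fun z => u z - φ z) G.inner z := by
    intro z hz hle φ hmax
    filter_upwards [hmax, self_mem_nhdsWithin] with y hy hyI
    have := hwu y hyI.1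
    have := hwu z hz.1
    linarith
  refine ⟨w, hwc, ⟨hwc.upperSemicontinuousOn, ?_, ?_⟩, ?_, by linarith, δ, hδ0, ?_⟩
  · intro j z hz hzI φ hφ hd hmax
    rcases lt_or_ge (u z) (w z) with hlt | hge
    · linarith [hstrict_edge j z hz hlt φ hd hmax]
    · exact hu.2.1 j z hz hzI φ hφ hd (hpass z hzI hge φ hmax)
  · intro i hi hzI j k hj hk hjk φ hφ hd hmax
    rcases lt_or_ge (u (G.vert i)) (w (G.vert i)) with hlt | hge
    · linarith [hstrict_vert i hi hlt j k hj hk φ hd hmax]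
    · exact hu.2.2 i hi hzI j k hj hk hjk φ hφ hd (hpass _ hzI hge φ hmax)
  · intro z hz hzU
    obtain ⟨k, hk⟩ := mem_iUnion.1 hz
    refine le_antisymm (not_lt.1 fun hlt => hzU ?_) (hwu z hz)
    obtain ⟨hxk, hle, -, -⟩ := hzone k _ (G.coord_mem hk) (by rwa [G.arc_coord hk])
    have := (hρ k hxk _ (G.coord_mem hk) hle).2.2.1
    rwa [G.arc_coord hk] at this
  · have hev : ∀ᶠ z in 𝓝[G.total] x, u z < w z :=
      (huc x hxt).eventually_lt (hwc x hxt) (by linarith)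
    rw [eventually_nhdsWithin_iff, eventually_nhds_iff] at hev
    obtain ⟨U', hU', hUo, hxU⟩ := hev
    refine ⟨U', hUo, hxU, hwc.upperSemicontinuousOn, ?_, ?_⟩
    · intro j z hz hzI φ hφ hd hmax
      linarith [hstrict_edge j z hz (hU' z hzI.2 hzI.1.1) φ hd hmax]
    · intro i hi hzI j k hj hk hjk φ hφ hd hmax
      linarith [hstrict_vert i hi (hU' _ hzI.2 hzI.1.1) j k hj hk φ hd hmax]

/-- A test function touching from below bounds the function from below, along an edge, by a cone
around the slope of the test function. -/
theorem cone_le_of_isLocalMinOn [Finite I] [Finite J] {u φ : EuclideanSpace ℝ (Fin N) → ℝ} {x}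
    (hx : x ∈ G.inner) {k : J} (hk : x ∈ G.closedEdge k) (hd : G.EdgeDiffAt k φ x)
    (hmin : IsLocalMinOn (fun z => u z - φ z) G.inner x) {η : ℝ} (hη : 0 < η) :
    ∀ᶠ s in 𝓝[Icc 0 (G.len k)] (G.coord k x),
      u x + G.edgeDeriv k φ x * (s - G.coord k x) - η * |s - G.coord k x| ≤ u (G.arc k s) := by
  have hev := eventually_along_edge hx hk hmin
  have hder := hd.hasDerivWithinAt
  rw [hasDerivWithinAt_iff_isLittleO] at hder
  filter_upwards [hev, hder.def hη] with s h1 h2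
  rw [G.arc_coord hk, Real.norm_eq_abs, Real.norm_eq_abs, smul_eq_mul] at h2
  have := neg_abs_le (φ (G.arc k s) - φ x - (s - G.coord k x) * G.edgeDeriv k φ x)
  linarith

/-- A continuous subsolution that cannot be lifted locally near the points of `Ω` is a supersolution
in `Ω`. -/
theorem IsSubsolution.isSupersolution_of_no_bump [Finite I] [Finite J] (hH : G.IsEikonal H)
    {u : EuclideanSpace ℝ (Fin N) → ℝ} (huc : ContinuousOn u G.total)
    (hu : G.IsSubsolution H G.inner u) {Ω} (hΩ : Ω ⊆ G.inner)
    (hno : ∀ x ∈ Ω, ∃ U ∈ 𝓝 x, ∀ w : EuclideanSpace ℝ (Fin N) → ℝ, ContinuousOn w G.total →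
      G.IsSubsolution H G.inner w → (∀ z ∈ G.total, z ∉ U → w z = u z) → u x < w x →
      ¬ ∃ δ > 0, ∃ U', IsOpen U' ∧ x ∈ U' ∧
        G.IsSubsolution (fun j s p => H j s p + δ) (G.inner ∩ U') w) :
    G.IsSupersolution H Ω u := by
  refine ⟨huc.lowerSemicontinuousOn, ?_, ?_⟩
  · rintro j x ⟨s₀, hs₀, rfl⟩ hx φ hφ hd hmin
    by_contra! hcon
    have hs := Ioo_subset_Icc_self hs₀
    have hxj := G.arc_mem j hs
    obtain ⟨U, hU, hno⟩ := hno _ hx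
    set x := G.arc j s₀ with hxdef
    set p := G.edgeDeriv j φ x with hp
    have hcont := continuous_right (hH.continuous j) (G.coord_mem hxj)
    obtain ⟨b, ⟨h1, h2⟩, hb⟩ : ∃ b : ℝ, (H j (G.coord j x) (p - b) < 0 ∧
        H j (G.coord j x) (p + b) < 0) ∧ 0 < b := by
      have c1 : Continuous fun b => H j (G.coord j x) (p - b) := hcont.comp (by fun_prop)
      have c2 : Continuous fun b => H j (G.coord j x) (p + b) := hcont.comp (by fun_prop)
      have e1 := (c1.tendsto 0).eventually (gt_mem_nhds (by rwa [sub_zero] : _ < (0 : ℝ)))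
      have e2 := (c2.tendsto 0).eventually (gt_mem_nhds (by rwa [add_zero] : _ < (0 : ℝ)))
      exact (((e1.and e2).filter_mono nhdsWithin_le_nhds).and
        (self_mem_nhdsWithin : Ioi (0 : ℝ) ∈ 𝓝[>] 0)).exists
    have huniq : ∀ k, x ∈ G.closedEdge k → k = j := fun k hk => G.edge_unique hs₀ hk
    obtain ⟨w, hwc, hw, hwU, hwx, hst⟩ := hu.exists_bump hH huc (hΩ hx) (m := fun _ => p)
      (b₀ := fun _ => b / 2) (b := fun _ => b)
      (fun h => absurd h (G.not_vert_of_mem_Ioo hs₀)) (fun _ _ => by positivity)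
      (fun _ _ => by linarith) (fun k hk => by rw [huniq k hk]; exact ⟨h1, h2⟩)
      (fun k hk => by
        rw [huniq k hk]
        exact cone_le_of_isLocalMinOn (hΩ hx) hxj hd hmin (half_pos hb)) hU
    exact hno w hwc hw hwU hwx hst
  · intro i hi hx j hj
    by_contra! hcon
    obtain ⟨U, hU, hno⟩ := hno _ hx
    have hxI := hΩ hx
    have key : ∀ k φ, G.Inc i k → G.EdgeDiffAt k φ (G.vert i) →
        IsLocalMinOn (fun z => u z - φ z) G.inner (G.vert i) →
        H k (G.coord k (G.vert i)) (G.edgeDeriv k φ (G.vert i)) < 0 →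
        ∃ b₀ b : ℝ, 0 ≤ b₀ ∧ b₀ < b ∧ (H k (G.coord k (G.vert i)) (0 - b) < 0 ∧
          H k (G.coord k (G.vert i)) (0 + b) < 0) ∧
          ∀ᶠ s in 𝓝[Icc 0 (G.len k)] (G.coord k (G.vert i)),
            u (G.vert i) + 0 * (s - G.coord k (G.vert i)) - b₀ * |s - G.coord k (G.vert i)| ≤
              u (G.arc k s) := by
      intro k φ hk hd hmin hlt
      set p := G.edgeDeriv k φ (G.vert i) with hp
      have hcont := continuous_right (hH.continuous k) (G.coord_mem hk)
      have habs : H k (G.coord k (G.vert i)) |p| < 0 := by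
        rcases abs_choice p with h | h
        · rwa [h]
        · rwa [h, ← hH.even i k hk]
      obtain ⟨η, h1, hη⟩ : ∃ η : ℝ, H k (G.coord k (G.vert i)) (|p| + η) < 0 ∧ 0 < η := by
        have c1 : Continuous fun b => H k (G.coord k (G.vert i)) (|p| + b) :=
          hcont.comp (by fun_prop)
        have e1 := (c1.tendsto 0).eventually (gt_mem_nhds (by rwa [add_zero] : _ < (0 : ℝ)))
        exact ((e1.filter_mono nhdsWithin_le_nhds).and
          (self_mem_nhdsWithin : Ioi (0 : ℝ) ∈ 𝓝[>] 0)).exists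
      refine ⟨|p| + η / 2, |p| + η, by positivity, by linarith, ⟨?_, by rwa [zero_add]⟩, ?_⟩
      · rwa [zero_sub, ← hH.even i k hk]
      · filter_upwards [cone_le_of_isLocalMinOn hxI hk hd hmin (half_pos hη)] with s hs
        have := neg_abs_le (p * (s - G.coord k (G.vert i)))
        rw [abs_mul] at this
        linarith
    have hall : ∀ k, ∃ b₀ b : ℝ, G.Inc i k → 0 ≤ b₀ ∧ b₀ < b ∧
        (H k (G.coord k (G.vert i)) (0 - b) < 0 ∧ H k (G.coord k (G.vert i)) (0 + b) < 0) ∧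
          ∀ᶠ s in 𝓝[Icc 0 (G.len k)] (G.coord k (G.vert i)),
            u (G.vert i) + 0 * (s - G.coord k (G.vert i)) - b₀ * |s - G.coord k (G.vert i)| ≤
              u (G.arc k s) := by
      intro k
      by_cases hk : G.Inc i k
      swap
      · exact ⟨0, 0, fun h => absurd h hk⟩
      by_cases hkj : k = j
      · -- the edge `j` itself is bounded by a test function for any partner
        subst hkj
        obtain ⟨k', hk', hne⟩ := G.exists_inc_ne hi k
        obtain ⟨φ, hφ, hd, hmin, hlt⟩ := hcon k' hk' hne
        obtain ⟨b₀, b, h⟩ := key k φ hk hd.1 hmin hlt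
        exact ⟨b₀, b, fun _ => h⟩
      · obtain ⟨φ, hφ, hd, hmin, hlt⟩ := hcon k hk hkj
        obtain ⟨b₀, b, h⟩ := key k φ hk hd.2.1 hmin (by rwa [hH.vert_edgeDeriv_eq hj hk hd])
        exact ⟨b₀, b, fun _ => h⟩
    choose b₀ b hb using hall
    obtain ⟨w, hwc, hw, hwU, hwx, hst⟩ := hu.exists_bump hH huc hxI (m := fun _ => 0)
      (b₀ := b₀) (b := b) (fun _ _ => rfl) (fun k hk => (hb k hk).1) (fun k hk => (hb k hk).2.1)
      (fun k hk => (hb k hk).2.2.1) (fun k hk => (hb k hk).2.2.2) hU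
    exact hno w hwc hw hwU hwx hst

end TopNetwork

/-! ### The representation formula -/

namespace TopNetwork

variable {N : ℕ} {I J : Type*} {G : TopNetwork N I J} {H : J → ℝ → ℝ → ℝ}

theorem IsEikonal.dist_self_le (hH : G.IsEikonal H) {x} (hx : x ∈ G.total) :
    G.dist H x x ≤ ((0 : ℝ) : EReal) := by
  obtain ⟨j, s, hs, rfl⟩ := mem_iUnion.1 hx
  obtain ⟨C, hC⟩ := hH.exists_dist_le_mul_abs j
  simpa using hC s hs s hs

theorem isCompact_union_bdry [Finite I] [Finite J] {K : Set (EuclideanSpace ℝ (Fin N))}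
    (hK : ∃ C, IsClosed C ∧ K = C ∩ G.inner) : IsCompact (K ∪ G.bdry) := by
  obtain ⟨C, hC, rfl⟩ := hK
  have : C ∩ G.inner ∪ G.bdry = C ∩ G.total ∪ G.bdry := by
    ext z
    simp only [inner, mem_union, mem_inter_iff, Set.mem_sdiff]
    tauto
  rw [this]
  exact (G.isCompact_total.inter_left hC).union (toFinite G.bdryIdx |>.image _).isCompact

/-- The minimum of `g(y) + S(y, x)` over a compact set of data points `y` is attained, and as a
function of `x` it is dominated by the distance. -/
theorem exists_isLeast_add_dist [Finite I] [Finite J] (hH : G.IsEikonal H)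
    (hsub : ∃ w : EuclideanSpace ℝ (Fin N) → ℝ,
      ContinuousOn w G.total ∧ G.IsSubsolution H G.inner w)
    {A : Set (EuclideanSpace ℝ (Fin N))} (hA : IsCompact A) (hne : A.Nonempty)
    (hAt : A ⊆ G.total) {g : EuclideanSpace ℝ (Fin N) → ℝ} (hg : ContinuousOn g G.total) :
    ∃ u : EuclideanSpace ℝ (Fin N) → ℝ,
      (∀ x ∈ G.total, IsLeast ((fun y => (g y : EReal) + G.dist H y x) '' A) (u x : EReal)) ∧
      ∀ y ∈ G.total, ∀ x ∈ G.total, ((u x - u y : ℝ) : EReal) ≤ G.dist H y x := by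
  classical
  obtain ⟨S, hS⟩ := hH.exists_real_dist hsub
  have htri : ∀ y ∈ G.total, ∀ x ∈ G.total, ∀ z ∈ G.total, S y z ≤ S y x + S x z := by
    intro y hy x hx z hz
    have := G.dist_triangle_of_le (hS y hy x hx).le (hS x hx z hz).le
    rw [hS y hy z hz] at this
    exact EReal.coe_le_coe_iff.1 this
  have hcont : ∀ x ∈ G.total, ContinuousOn (fun y => g y + S y x) A := by
    intro x hx
    have h1 : ContinuousOn (fun y => -S y x) G.total := by
      refine continuousOn_of_sub_le_dist hH fun y hy z hz => ?_
      rw [hS y hy z hz, EReal.coe_le_coe_iff]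
      linarith [htri y hy z hz x hx]
    refine ((hg.sub h1).mono hAt).congr fun y _ => ?_
    simp only [Pi.sub_apply, sub_neg_eq_add]
  have hmin : ∀ x, ∃ r : ℝ, x ∈ G.total → IsLeast ((fun y => g y + S y x) '' A) r := by
    intro x
    by_cases hx : x ∈ G.total
    · obtain ⟨y, hy, hymin⟩ := hA.exists_isMinOn hne (hcont x hx)
      exact ⟨g y + S y x, fun _ => ⟨mem_image_of_mem _ hy, by
        rintro _ ⟨z, hz, rfl⟩; exact hymin hz⟩⟩
    · exact ⟨0, fun h => absurd h hx⟩
  choose u hu using hmin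
  refine ⟨u, fun x hx => ?_, fun y hy x hx => ?_⟩
  · have e : ∀ y ∈ A, (g y : EReal) + G.dist H y x = ((g y + S y x : ℝ) : EReal) :=
      fun y hy => by rw [hS y (hAt hy) x hx, EReal.coe_add]
    obtain ⟨⟨y, hy, hyx⟩, hlow⟩ := hu x hx
    refine ⟨⟨y, hy, ?_⟩, ?_⟩
    · simp only at hyx
      simp only [e y hy, hyx]
    · rintro _ ⟨z, hz, rfl⟩
      simp only [e z hz]
      exact EReal.coe_le_coe_iff.2 (hlow ⟨z, hz, rfl⟩)
  · obtain ⟨⟨a, ha, hay⟩, -⟩ := hu y hy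
    have h1 := (hu x hx).2 ⟨a, ha, rfl⟩
    simp only at hay h1
    rw [hS y hy x hx, EReal.coe_le_coe_iff]
    linarith [htri a (hAt ha) y hy x hx]

end TopNetwork

theorem mainTheorem5 {N : ℕ} {I J : Type*} [Finite I] [Finite J] (G : TopNetwork N I J)
    (H : J → ℝ → ℝ → ℝ) (hH : G.IsEikonal H)
    (hsub : ∃ w : EuclideanSpace ℝ (Fin N) → ℝ,
      ContinuousOn w G.total ∧ G.IsSubsolution H G.inner w)
    (K : Set (EuclideanSpace ℝ (Fin N)))
    (hK : ∃ C, IsClosed C ∧ K = C ∩ G.inner)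
    (hstrict : G.HasStrictSubsolutionOff H K)
    (g : EuclideanSpace ℝ (Fin N) → ℝ) (hg : ContinuousOn g G.total) :
    ∃ u : EuclideanSpace ℝ (Fin N) → ℝ,
      (∀ x ∈ G.total,
        IsLeast ((fun y => (g y : EReal) + G.dist H y x) '' (K ∪ G.bdry)) (u x : EReal)) ∧
      (ContinuousOn u G.total ∧ G.IsSubsolution H G.inner u ∧
        G.IsSupersolution H (G.inner \ K) u) ∧
      (K ⊆ G.degenerateSet H → G.IsSolution H G.inner u) ∧
      (∀ x ∈ K ∪ G.bdry, u x ≤ g x) ∧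
      (∀ v : EuclideanSpace ℝ (Fin N) → ℝ,
        ContinuousOn v G.total → G.IsSubsolution H G.inner v →
        G.IsSupersolution H (G.inner \ K) v →
        (∀ x ∈ K ∪ G.bdry, v x ≤ g x) → ∀ x ∈ G.total, v x ≤ u x) := by
  have hA := TopNetwork.isCompact_union_bdry hK
  have hAt : K ∪ G.bdry ⊆ G.total := by
    rintro z (hz | ⟨i, -, rfl⟩)
    · obtain ⟨C, -, rfl⟩ := hK
      exact hz.2.1
    · exact G.vert_mem_total i
  have hne : (K ∪ G.bdry).Nonempty := (G.bdryIdx_nonempty.image _).mono subset_union_right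
  obtain ⟨u, hmin, hdom⟩ := TopNetwork.exists_isLeast_add_dist hH hsub hA hne hAt hg
  have hZ : ∀ j, ∀ s ∈ Icc 0 (G.len j), ∃ p, H j s p ≤ 0 := fun j s hs =>
    let ⟨_, hwc, hw⟩ := hsub
    hw.exists_le_zero hH hwc j hs
  have huc := TopNetwork.continuousOn_of_sub_le_dist hH hdom
  have hu := TopNetwork.isSubsolution_of_sub_le_dist hH hZ hdom
  have hug : ∀ x ∈ K ∪ G.bdry, u x ≤ g x := by
    intro x hx
    have h1 := (hmin x (hAt hx)).2 ⟨x, hx, rfl⟩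
    have h2 := h1.trans (add_le_add_right (hH.dist_self_le (hAt hx)) (g x : EReal))
    rw [← EReal.coe_add, add_zero] at h2
    exact EReal.coe_le_coe_iff.1 h2
  have hmax : ∀ v : EuclideanSpace ℝ (Fin N) → ℝ, ContinuousOn v G.total →
      G.IsSubsolution H G.inner v → (∀ x ∈ K ∪ G.bdry, v x ≤ g x) →
      ∀ x ∈ G.total, v x ≤ u x := by
    intro v hvc hv hvg x hx
    obtain ⟨y, hy, hyx⟩ := (hmin x hx).1
    have h1 := add_le_add_right (hv.sub_le_dist hH hvc y x) (g y : EReal)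
    simp only at hyx
    rw [hyx, ← EReal.coe_add] at h1
    have := EReal.coe_le_coe_iff.1 h1
    linarith [hvg y hy]
  -- off `K`, a local lift of `u` would still be an admissible competitor
  have hnoK : ∀ x ∈ G.inner \ K, ∃ U ∈ 𝓝 x, ∀ w : EuclideanSpace ℝ (Fin N) → ℝ,
      ContinuousOn w G.total → G.IsSubsolution H G.inner w →
      (∀ z ∈ G.total, z ∉ U → w z = u z) → ¬ u x < w x := by
    intro x hx
    refine ⟨(K ∪ G.bdry)ᶜ, hA.isClosed.isOpen_compl.mem_nhds ?_, ?_⟩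
    · rintro (h | h)
      exacts [hx.2 h, hx.1.2 h]
    · intro w hwc hw hwU
      refine not_lt.2 (hmax w hwc hw (fun z hz => ?_) x hx.1.1)
      rw [hwU z (hAt hz) (not_not.2 hz)]
      exact hug z hz
  refine ⟨u, hmin, ⟨huc, hu, ?_⟩, fun hdeg => ⟨huc, hu, ?_⟩, hug,
    fun v hvc hv _ hvg => hmax v hvc hv hvg⟩
  · refine hu.isSupersolution_of_no_bump hH huc sdiff_subset fun x hx => ?_
    obtain ⟨U, hU, h⟩ := hnoK x hx
    exact ⟨U, hU, fun w hwc hw hwU hwx _ => h w hwc hw hwU hwx⟩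
  · refine hu.isSupersolution_of_no_bump hH huc Subset.rfl fun x hx => ?_
    by_cases hxK : x ∈ K
    · exact ⟨univ, univ_mem, fun w hwc hw _ _ hst => (hdeg hxK).2 ⟨w, hwc, hw, hst⟩⟩
    · obtain ⟨U, hU, h⟩ := hnoK x ⟨hx, hxK⟩
      exact ⟨U, hU, fun w hwc hw hwU hwx _ => h w hwc hw hwU hwx⟩
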